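/- All graphs are finite and simple. A \emph{straight-line drawing} of a graph $G$ represents the vertices of $G$ by distinct points of the plane and every edge by the straight-line segment connecting its two ends, such that this segment does not pass through any other vertex of $G$ (edges may cross each other). A \emph{supercycle} is a connected graph in which every degree is at least two and not all degrees are equal to two. A \emph{cut} of $G$ is a partition of the vertex set into two sets, and its \emph{cut-edges} are the edges whose ends lie in different sets; it is an \emph{$M$-cut} if the cut-edges form a matching (their ends are pairwise different vertices). An $M$-cut is \emph{suitable} if after deleting the cut-edges the graph has exactly two connected components, both of which are supercycles. \textbf{Lemma.} Let $G$ be a connected cubic ($3$-regular) graph that has a suitable $M$-cut. Then $G$ can be drawn with the four basic slopes, that is, $G$ has a straight-line drawing in which every edge has one of the four slopes (angles of inclination) $0$, $\pi/4$, $\pi/2$, $3\pi/4$. -/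

import Mathlib

namespace FourSlopes

/-- A supercycle: a connected (finite) graph in which every degree is at least two and not all
degrees are equal to two. -/
def IsSupercycle {W : Type*} [Finite W] (H : SimpleGraph W) : Prop :=
  H.Connected ∧ (∀ v, 2 ≤ (H.neighborSet v).ncard) ∧ ¬ ∀ v, (H.neighborSet v).ncard = 2

/-- The cut-edges of the cut `(A, Aᶜ)`: the edges with ends in different parts. -/
def cutEdges {V : Type*} (G : SimpleGraph V) (A : Set V) : Set (Sym2 V) :=
  {e | e ∈ G.edgeSet ∧ ∃ u ∈ A, ∃ v ∈ Aᶜ, e = s(u, v)}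

/-- The cut `(A, Aᶜ)` is an `M`-cut: its cut-edges form a matching, that is, distinct cut-edges
have no common end. -/
def IsMCut {V : Type*} (G : SimpleGraph V) (A : Set V) : Prop :=
  ∀ e ∈ cutEdges G A, ∀ f ∈ cutEdges G A, e ≠ f → ∀ v, v ∈ e → v ∉ f

/-- The cut `(A, Aᶜ)` is a suitable `M`-cut: it is an `M`-cut, and after deleting the cut-edges the
graph has exactly two connected components, both of which are supercycles. -/
def IsSuitableMCut {V : Type*} [Finite V] (G : SimpleGraph V) (A : Set V) : Prop :=
  IsMCut G A ∧
    Nat.card (G.deleteEdges (cutEdges G A)).ConnectedComponent = 2 ∧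
    ∀ C : (G.deleteEdges (cutEdges G A)).ConnectedComponent, IsSupercycle C.toSimpleGraph

/-- `p` is a straight-line drawing of `G`: distinct vertices are distinct points of the plane, and
the segment that represents an edge contains no vertex other than its two ends.
(Edges are allowed to cross.) -/
def IsStraightLineDrawing {V : Type*} (G : SimpleGraph V) (p : V → ℝ × ℝ) : Prop :=
  Function.Injective p ∧
    ∀ u v, G.Adj u v → ∀ w, w ≠ u → w ≠ v → p w ∉ segment ℝ (p u) (p v)

/-- The line through the distinct points `a` and `b` has slope (angle of inclination) `θ`. -/
def HasSlope (θ : ℝ) (a b : ℝ × ℝ) : Prop :=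
  ∃ t : ℝ, t ≠ 0 ∧ b - a = t • (Real.cos θ, Real.sin θ)

/-- The four basic slopes, as angles. -/
def basicSlopes : Set ℝ := {0, Real.pi / 4, Real.pi / 2, 3 * Real.pi / 4}

/-- `G` can be drawn with the slopes in `S`: it has a straight-line drawing in which the slope of
every edge belongs to `S`. -/
def CanBeDrawnWith {V : Type*} (G : SimpleGraph V) (S : Set ℝ) : Prop :=
  ∃ p : V → ℝ × ℝ, IsStraightLineDrawing G p ∧
    ∀ u v, G.Adj u v → ∃ θ ∈ S, HasSlope θ (p u) (p v)

end FourSlopes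

/-! In a component left by the cut every vertex keeps degree at least two, so it meets at most one
cut-edge, and the ends of cut-edges are exactly the vertices of degree two in their components. It
suffices to draw each component with prescribed abscissas at these vertices and with nothing
straight above them. If the two ends of every cut-edge get the same abscissa, and one drawing is
turned upside down and placed far above the other, then the cut-edges become vertical segments that
meet nothing else (`exists_drawn_union`, resting on `Drawn.stack`).

The prescribed abscissas are linearly independent over ℚ. An abscissa forced by the construction of
a cycle is a rational combination of prescribed ones, and free choices avoid a countable set, so
harmful coincidences do not occur.

A single component is drawn by induction on the number of vertices (`drawable`). Removing a vertex
lowers degrees and may disconnect, so the induction runs over induced subgraphs `G[U]` and proves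
three statements together: `Drawable`, `TopDrawable` and `SplitDrawable`. In the typical step `d`
has degree two, with neighbours `a` and `b`, and `b` has degree three. The rest is drawn with `a`
highest and with `b`, now of degree two, at the abscissa intended for `d`; then `d` goes on top,
with `da` diagonal and `db` vertical (`Branch.exists_fits_above`).

This is blocked when the removal of `d` leaves `b` on a component that is a cycle. Such a cycle is
drawn separately with all abscissas but one prescribed (`exists_cycle_drawn`), and `d` is joined to
it by a diagonal or by a long horizontal edge. If both neighbours have degree two, the rest is drawn
in two parts, and the upper one is lifted until a far vertex `d` sees one neighbour horizontally and
the other diagonally (`SplitFits.insert_far`). -/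

namespace FourSlopes

open scoped Classical

variable {V : Type*} {G : SimpleGraph V}

/-! ### Partial drawings -/

/-- The points `(X v, Y v)` form a straight-line drawing of `G[U]` in which every edge is
horizontal, vertical or diagonal. -/
structure Drawn (G : SimpleGraph V) (U : Finset V) (X Y : V → ℝ) : Prop where
  inj : ∀ u ∈ U, ∀ v ∈ U, X u = X v → Y u = Y v → u = v
  slope : ∀ u ∈ U, ∀ v ∈ U, G.Adj u v → X u = X v ∨ Y u = Y v ∨ |X u - X v| = |Y u - Y v|
  clear : ∀ u ∈ U, ∀ v ∈ U, G.Adj u v → ∀ w ∈ U, w ≠ u → w ≠ v → ∀ t : ℝ, 0 ≤ t → t ≤ 1 →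
    X w = X u + t * (X v - X u) → Y w = Y u + t * (Y v - Y u) → False

/-- No vertex of `U` lies to the north of `v`. -/
def NorthFree (U : Finset V) (X Y : V → ℝ) (v : V) : Prop :=
  ∀ u ∈ U, u ≠ v → X u = X v → Y u < Y v

/-- No vertex of `U` lies to the south of `v`. -/
def SouthFree (U : Finset V) (X Y : V → ℝ) (v : V) : Prop :=
  ∀ u ∈ U, u ≠ v → X u = X v → Y v < Y u

theorem Drawn.congr {U : Finset V} {X Y X' Y' : V → ℝ} (h : Drawn G U X Y)
    (hX : ∀ u ∈ U, X' u = X u) (hY : ∀ u ∈ U, Y' u = Y u) : Drawn G U X' Y' where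
  inj u hu v hv := by
    rw [hX u hu, hX v hv, hY u hu, hY v hv]; exact h.inj u hu v hv
  slope u hu v hv := by
    rw [hX u hu, hX v hv, hY u hu, hY v hv]; exact h.slope u hu v hv
  clear u hu v hv huv w hw := by
    rw [hX u hu, hX v hv, hY u hu, hY v hv, hX w hw, hY w hw]; exact h.clear u hu v hv huv w hw

theorem NorthFree.congr {U : Finset V} {X Y X' Y' : V → ℝ} {v : V} (h : NorthFree U X Y v)
    (hv : v ∈ U) (hX : ∀ u ∈ U, X' u = X u) (hY : ∀ u ∈ U, Y' u = Y u) :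
    NorthFree U X' Y' v := by
  intro u hu
  rw [hX u hu, hX v hv, hY u hu, hY v hv]
  exact h u hu

theorem Drawn.flip {U : Finset V} {X Y : V → ℝ} (h : Drawn G U X Y) :
    Drawn G U X (fun v => - Y v) where
  inj u hu v hv hx hy := h.inj u hu v hv hx (neg_injective hy)
  slope u hu v hv huv := by
    rcases h.slope u hu v hv huv with h | h | h
    · exact Or.inl h
    · exact Or.inr (Or.inl (by simp [h]))
    · refine Or.inr (Or.inr ?_)
      rw [h, ← abs_neg]; congr 1; ring
  clear u hu v hv huv w hw h1 h2 t h3 h4 hx hy :=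
    h.clear u hu v hv huv w hw h1 h2 t h3 h4 hx (by linarith)

theorem Drawn.shift {U : Finset V} {X Y : V → ℝ} (h : Drawn G U X Y) (c : ℝ) :
    Drawn G U X (fun v => Y v + c) where
  inj u hu v hv hx hy := h.inj u hu v hv hx (by simpa using hy)
  slope u hu v hv huv := by
    rcases h.slope u hu v hv huv with h | h | h
    · exact Or.inl h
    · exact Or.inr (Or.inl (by simp [h]))
    · refine Or.inr (Or.inr ?_)
      rw [h]; congr 1; ring
  clear u hu v hv huv w hw h1 h2 t h3 h4 hx hy :=
    h.clear u hu v hv huv w hw h1 h2 t h3 h4 hx (by linarith)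

theorem lt_segment {a b c t : ℝ} (ha : c < a) (hb : c < b) (h0 : 0 ≤ t) (h1 : t ≤ 1) :
    c < a + t * (b - a) := by
  rcases h0.eq_or_lt with rfl | h0
  · linarith
  · nlinarith

theorem segment_lt {a b c t : ℝ} (ha : a < c) (hb : b < c) (h0 : 0 ≤ t) (h1 : t ≤ 1) :
    a + t * (b - a) < c := by
  have := lt_segment (neg_lt_neg ha) (neg_lt_neg hb) h0 h1
  linarith

/-- To draw `S₁ ∪ S₂` with `S₂` above `S₁`, the edges between the two parts have to be vertical
with free ends, or diagonals from a highest vertex of `S₁` to a lowest vertex of `S₂`. -/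
theorem Drawn.stack {S₁ S₂ : Finset V} {X Y : V → ℝ} (h₁ : Drawn G S₁ X Y) (h₂ : Drawn G S₂ X Y)
    (hlt : ∀ u ∈ S₁, ∀ v ∈ S₂, Y u < Y v)
    (hcross : ∀ u ∈ S₁, ∀ v ∈ S₂, G.Adj u v →
      (X u = X v ∧ NorthFree S₁ X Y u ∧ SouthFree S₂ X Y v) ∨
      (|X u - X v| = |Y u - Y v| ∧ (∀ w ∈ S₁, Y w ≤ Y u) ∧ ∀ w ∈ S₂, Y v ≤ Y w)) :
    Drawn G (S₁ ∪ S₂) X Y := by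
  have key : ∀ u ∈ S₁, ∀ v ∈ S₂, G.Adj u v → ∀ w ∈ S₁ ∪ S₂, w ≠ u → w ≠ v →
      ∀ t : ℝ, 0 ≤ t → t ≤ 1 →
      X w = X u + t * (X v - X u) → Y w = Y u + t * (Y v - Y u) → False := by
    intro u hu v hv huv w hw hwu hwv t h0 h1 hx hy
    have huv' := hlt u hu v hv
    rcases hcross u hu v hv huv with ⟨he, hn, hs⟩ | ⟨_, htop, hbot⟩
    · have hx' : X w = X u := by rw [hx, he]; ring
      rcases Finset.mem_union.1 hw with hw | hw
      · have := hn w hw hwu hx'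
        nlinarith
      · have := hs w hw hwv (hx'.trans he)
        nlinarith
    · rcases Finset.mem_union.1 hw with hw | hw
      · have h2 := htop w hw
        -- The edge rises strictly from a highest vertex of the lower part, so it meets that part
        -- only at its start; symmetrically for the upper part.
        have ht : t = 0 := by
          by_contra hne
          have : 0 < t := lt_of_le_of_ne h0 (Ne.symm hne)
          nlinarith
        subst ht
        exact hwu (h₁.inj w hw u hu (by linarith) (by linarith))
      · have h2 := hbot w hw
        have ht : t = 1 := by
          by_contra hne
          have : t < 1 := lt_of_le_of_ne h1 hne
          nlinarith
        subst ht
        exact hwv (h₂.inj w hw v hv (by linarith) (by linarith))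
  refine ⟨?_, ?_, ?_⟩
  · intro u hu v hv hx hy
    rcases Finset.mem_union.1 hu with hu | hu <;> rcases Finset.mem_union.1 hv with hv | hv
    · exact h₁.inj u hu v hv hx hy
    · exact absurd hy (hlt u hu v hv).ne
    · exact absurd hy (hlt v hv u hu).ne'
    · exact h₂.inj u hu v hv hx hy
  · intro u hu v hv huv
    rcases Finset.mem_union.1 hu with hu | hu <;> rcases Finset.mem_union.1 hv with hv | hv
    · exact h₁.slope u hu v hv huv
    · rcases hcross u hu v hv huv with h | h
      · exact Or.inl h.1
      · exact Or.inr (Or.inr h.1)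
    · rcases hcross v hv u hu huv.symm with h | h
      · exact Or.inl h.1.symm
      · refine Or.inr (Or.inr ?_)
        rw [abs_sub_comm, h.1, abs_sub_comm]
    · exact h₂.slope u hu v hv huv
  · intro u hu v hv huv w hw hwu hwv t h0 h1 hx hy
    rcases Finset.mem_union.1 hu with hu | hu <;> rcases Finset.mem_union.1 hv with hv | hv
    · rcases Finset.mem_union.1 hw with hw | hw
      · exact h₁.clear u hu v hv huv w hw hwu hwv t h0 h1 hx hy
      · exact (segment_lt (hlt u hu w hw) (hlt v hv w hw) h0 h1).ne' hy
    · exact key u hu v hv huv w hw hwu hwv t h0 h1 hx hy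
    · exact key v hv u hu huv.symm w hw hwv hwu (1 - t) (by linarith) (by linarith)
        (by linarith) (by linarith)
    · rcases Finset.mem_union.1 hw with hw | hw
      · exact (lt_segment (hlt w hw u hu) (hlt w hw v hv) h0 h1).ne hy
      · exact h₂.clear u hu v hv huv w hw hwu hwv t h0 h1 hx hy

theorem Drawn.singleton (v : V) (X Y : V → ℝ) : Drawn G {v} X Y where
  inj u hu w hw _ _ := by simp at hu hw; rw [hu, hw]
  slope u hu w hw h := by simp at hu hw; subst hu hw; exact absurd h (G.loopless.irrefl _)
  clear u hu w hw h := by simp at hu hw; subst hu hw; exact absurd h (G.loopless.irrefl _)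

theorem Drawn.empty (X Y : V → ℝ) : Drawn G ∅ X Y :=
  ⟨by simp, by simp, by simp⟩

/-- Adding a vertex that lies strictly to the left (`σ = 1`) or to the right (`σ = -1`) of all the
others. -/
theorem Drawn.insert_extreme {S : Finset V} {X Y : V → ℝ} (h : Drawn G S X Y) {v : V} {σ : ℝ}
    (hσ : ∀ u ∈ S, σ * X v < σ * X u)
    (hslope : ∀ u ∈ S, G.Adj v u → X v = X u ∨ Y v = Y u ∨ |X v - X u| = |Y v - Y u|)
    (hclear : ∀ u ∈ S, G.Adj v u → ∀ w ∈ S, w ≠ u → ∀ t : ℝ, 0 ≤ t → t ≤ 1 →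
      X w = X v + t * (X u - X v) → Y w = Y v + t * (Y u - Y v) → False) :
    Drawn G (insert v S) X Y := by
  have hne : ∀ u ∈ S, X v ≠ X u := fun u hu he => by
    have := hσ u hu
    rw [he] at this; exact lt_irrefl _ this
  refine ⟨?_, ?_, ?_⟩
  · intro a ha b hb hx hy
    rcases Finset.mem_insert.1 ha with rfl | ha' <;> rcases Finset.mem_insert.1 hb with rfl | hb'
    · rfl
    · exact absurd hx (hne b hb')
    · exact absurd hx.symm (hne a ha')
    · exact h.inj a ha' b hb' hx hy
  · intro a ha b hb hab
    rcases Finset.mem_insert.1 ha with rfl | ha' <;> rcases Finset.mem_insert.1 hb with rfl | hb'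
    · exact absurd hab (G.loopless.irrefl _)
    · exact hslope b hb' hab
    · rcases hslope a ha' hab.symm with h | h | h
      · exact Or.inl h.symm
      · exact Or.inr (Or.inl h.symm)
      · refine Or.inr (Or.inr ?_)
        rw [abs_sub_comm, h, abs_sub_comm]
    · exact h.slope a ha' b hb' hab
  · intro a ha b hb hab w hw hwa hwb t h0 h1 hx hy
    rcases Finset.mem_insert.1 ha with rfl | ha' <;> rcases Finset.mem_insert.1 hb with rfl | hb'
    · exact absurd hab (G.loopless.irrefl _)
    · exact hclear b hb' hab w ((Finset.mem_insert.1 hw).resolve_left hwa) hwb t h0 h1 hx hy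
    · exact hclear a ha' hab.symm w ((Finset.mem_insert.1 hw).resolve_left hwb) hwa (1 - t)
        (by linarith) (by linarith) (by linarith) (by linarith)
    · rcases Finset.mem_insert.1 hw with rfl | hw'
      · have h2 := hσ a ha'
        have h3 := hσ b hb'
        have h4 : σ * X w = σ * X a + t * (σ * X b - σ * X a) := by rw [hx]; ring
        exact (lt_segment h2 h3 h0 h1).ne h4
      · exact h.clear a ha' b hb' hab w hw' hwa hwb t h0 h1 hx hy

/-- Adding a vertex `v` above a highest vertex `a`: the edge `va` is a diagonal, and all other edges
of `v` are vertical. -/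
theorem Drawn.insert_top {S : Finset V} {X Y : V → ℝ} (h : Drawn G S X Y) {a v : V}
    (haS : a ∈ S) (htop : ∀ u ∈ S, Y u ≤ Y a) (hne : X v ≠ X a)
    (hY : Y v = Y a + |X v - X a|)
    (hnb : ∀ u ∈ S, G.Adj v u → u = a ∨ (X u = X v ∧ NorthFree S X Y u)) :
    Drawn G (insert v S) X Y := by
  have hpos : 0 < |X v - X a| := abs_pos.2 (sub_ne_zero.2 hne)
  rw [Finset.insert_eq, Finset.union_comm]
  refine h.stack (Drawn.singleton v X Y) ?_ ?_
  · intro u hu w hw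
    rw [Finset.mem_singleton.1 hw]
    linarith [htop u hu]
  · intro u hu w hw huw
    obtain rfl := Finset.mem_singleton.1 hw
    rcases hnb u hu huw.symm with rfl | ⟨h1, h2⟩
    · right
      refine ⟨?_, htop, fun w' hw' => by rw [Finset.mem_singleton.1 hw']⟩
      rw [abs_sub_comm, hY, show Y u - (Y u + |X w - X u|) = -|X w - X u| by ring, abs_neg,
        abs_abs]
    · left
      refine ⟨h1, h2, fun w₁ hw₁ hw => absurd (Finset.mem_singleton.1 hw₁) hw⟩

/-! ### Degrees in a set of vertices, and closed sets -/

/-- The number of neighbours of `v` in `U`. -/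
noncomputable def dg (G : SimpleGraph V) (U : Finset V) (v : V) : ℕ :=
  (U.filter (G.Adj v)).card

/-- `K` is a union of connected components of `G[U]`. -/
def IsClosedIn (G : SimpleGraph V) (U K : Finset V) : Prop :=
  K ⊆ U ∧ ∀ u ∈ K, ∀ v ∈ U, G.Adj u v → v ∈ K

theorem dg_erase_of_adj {U : Finset V} {d v : V} (hd : d ∈ U) (h : G.Adj v d) :
    dg G (U.erase d) v + 1 = dg G U v := by
  unfold dg
  rw [Finset.filter_erase, Finset.card_erase_add_one (Finset.mem_filter.2 ⟨hd, h⟩)]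

theorem dg_erase_of_not_adj {U : Finset V} {d v : V} (h : ¬ G.Adj v d) :
    dg G (U.erase d) v = dg G U v := by
  unfold dg
  rw [Finset.filter_erase, Finset.erase_eq_of_notMem (by simp [h])]

theorem dg_sdiff {U C : Finset V} (hC : IsClosedIn G U C) {v : V} (hv : v ∈ U) (hvC : v ∉ C) :
    dg G (U \ C) v = dg G U v := by
  unfold dg
  congr 1
  ext u
  simp only [Finset.mem_filter, Finset.mem_sdiff]
  exact ⟨fun h => ⟨h.1.1, h.2⟩, fun h => ⟨⟨h.1, fun hu => hvC (hC.2 u hu v hv h.2.symm)⟩, h.2⟩⟩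

theorem exists_nbr_of_dg_eq_one {U : Finset V} {v : V} (h : dg G U v = 1) :
    ∃ a ∈ U, G.Adj v a ∧ ∀ u ∈ U, G.Adj v u → u = a := by
  obtain ⟨a, ha⟩ := Finset.card_eq_one.1 h
  have h1 : ∀ u, u ∈ U ∧ G.Adj v u ↔ u = a := fun u => by
    rw [← Finset.mem_filter, ha, Finset.mem_singleton]
  exact ⟨a, ((h1 a).2 rfl).1, ((h1 a).2 rfl).2, fun u hu huv => (h1 u).1 ⟨hu, huv⟩⟩

theorem exists_nbrs_of_dg_eq_two {U : Finset V} {v : V} (h : dg G U v = 2) :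
    ∃ a ∈ U, ∃ b ∈ U, a ≠ b ∧ G.Adj v a ∧ G.Adj v b ∧ ∀ u ∈ U, G.Adj v u → u = a ∨ u = b := by
  obtain ⟨a, b, hab, ha⟩ := Finset.card_eq_two.1 h
  have h1 : ∀ u, u ∈ U ∧ G.Adj v u ↔ u = a ∨ u = b := fun u => by
    rw [← Finset.mem_filter, ha, Finset.mem_insert, Finset.mem_singleton]
  have h2 := (h1 a).2 (Or.inl rfl)
  have h3 := (h1 b).2 (Or.inr rfl)
  exact ⟨a, h2.1, b, h3.1, hab, h2.2, h3.2, fun u hu huv => (h1 u).1 ⟨hu, huv⟩⟩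

theorem IsClosedIn.exists_minimal {U K : Finset V} (hK : IsClosedIn G U K) {v : V} (hv : v ∈ K) :
    ∃ C ⊆ K, IsClosedIn G U C ∧ v ∈ C ∧
      ∀ D ⊆ C, IsClosedIn G U D → v ∈ D → D = C := by
  have hne : (K.powerset.filter fun C => IsClosedIn G U C ∧ v ∈ C).Nonempty :=
    ⟨K, by simp [hK, hv]⟩
  obtain ⟨C, hC, hmin⟩ := Finset.exists_min_image _ Finset.card hne
  simp only [Finset.mem_filter, Finset.mem_powerset] at hC hmin
  refine ⟨C, hC.1, hC.2.1, hC.2.2, fun D hD h1 h2 => ?_⟩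
  exact Finset.eq_of_subset_of_card_le hD (hmin D ⟨hD.trans hC.1, h1, h2⟩)

/-! ### Induced paths -/

/-- `K` induces a path in `G` that leads from `s` to `t`. -/
inductive InducedPath (G : SimpleGraph V) (s : V) : Finset V → V → Prop
  | single : InducedPath G s {s} s
  | cons {K : Finset V} {t v : V} : InducedPath G s K t → v ∉ K →
      (∀ u ∈ K, G.Adj v u ↔ u = t) → InducedPath G s (insert v K) v

theorem InducedPath.mem {s t : V} {K : Finset V} (h : InducedPath G s K t) : s ∈ K ∧ t ∈ K := by
  induction h with
  | single => simp
  | cons h hv _ ih => exact ⟨Finset.mem_insert_of_mem ih.1, Finset.mem_insert_self _ _⟩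

theorem InducedPath.eq_singleton {s : V} {K : Finset V} (h : InducedPath G s K s) : K = {s} := by
  cases h with
  | single => rfl
  | cons h hv _ => exact absurd h.mem.1 hv

theorem InducedPath.exists_prev {s t : V} {K : Finset V} (h : InducedPath G s K t) (hst : t ≠ s) :
    ∃ q ∈ K, G.Adj t q ∧ ∀ u ∈ K, G.Adj t u → u = q := by
  cases h with
  | single => exact absurd rfl hst
  | @cons K q _ h hv ha =>
    refine ⟨q, Finset.mem_insert_of_mem h.mem.2, (ha q h.mem.2).2 rfl, fun u hu hut => ?_⟩
    rcases Finset.mem_insert.1 hu with rfl | hu'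
    · exact absurd hut (G.loopless.irrefl _)
    · exact (ha u hu').1 hut

/-- A minimal closed set all of whose degrees are two is a cycle. -/
theorem exists_inducedPath_erase {U C : Finset V} {v : V} (hC : IsClosedIn G U C) (hv : v ∈ C)
    (hdg : ∀ u ∈ C, dg G U u = 2) (hmin : ∀ D ⊆ C, IsClosedIn G U D → v ∈ D → D = C) :
    ∃ s t, s ≠ t ∧ InducedPath G s (C.erase v) t ∧
      ∀ u ∈ C, G.Adj v u ↔ u = s ∨ u = t := by
  obtain ⟨s, hsU, t, htU, hst, hvs, hvt, hvn⟩ := exists_nbrs_of_dg_eq_two (hdg v hv)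
  have hsC := hC.2 v hv s hsU hvs
  have htC := hC.2 v hv t htU hvt
  refine ⟨s, t, hst, ?_, fun u hu => ⟨hvn u (hC.1 hu), by rintro (rfl | rfl) <;> assumption⟩⟩
  by_contra hcon
  -- If the claim fails, a path from `s` that avoids `v` can be prolonged forever inside the finite
  -- set `C`. The invariant is that only its end `r` may have neighbours outside `insert v K`.
  have main : ∀ n : ℕ, ∃ K r, InducedPath G s K r ∧ K ⊆ C.erase v ∧
      (∀ u ∈ K, u ≠ r → ∀ w ∈ U, G.Adj u w → w ∈ insert v K) ∧ n < K.card := by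
    intro n
    induction n with
    | zero =>
      refine ⟨{s}, s, .single, ?_, ?_, by simp⟩
      · simpa [hsC] using hvs.ne'
      · simp
    | succ n ih =>
      obtain ⟨K, r, hK, hKC, hcl, hn⟩ := ih
      have hrC : r ∈ C := Finset.mem_of_mem_erase (hKC hK.mem.2)
      have hrn := hdg r hrC
      obtain ⟨e, heU, f, hfU, hef, hre, hrf, hrn⟩ := exists_nbrs_of_dg_eq_two hrn
      have hprev : ∃ w₀ ∈ insert v K, G.Adj r w₀ := by
        by_cases hrs : r = s
        · exact ⟨v, Finset.mem_insert_self _ _, hrs ▸ hvs.symm⟩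
        · obtain ⟨q, hq, hrq, -⟩ := hK.exists_prev hrs
          exact ⟨q, Finset.mem_insert_of_mem hq, hrq⟩
      have hout : ∃ w ∈ U, G.Adj r w ∧ w ∉ insert v K := by
        by_contra hno
        push Not at hno
        -- A path that cannot be prolonged has an end adjacent to `v` and different from `s`, since
        -- `s` has a second neighbour. So it ends in `t`, and together with `v` it is closed, hence
        -- all of `C` by minimality.
        have hrt : r = t := by
          by_cases hrs : r = s
          · subst hrs
            have h1 := hno e heU hre
            have h2 := hno f hfU hrf
            rw [hK.eq_singleton, Finset.mem_insert, Finset.mem_singleton] at h1 h2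
            have h3 : e = v := h1.resolve_right hre.ne'
            have h4 : f = v := h2.resolve_right hrf.ne'
            exact absurd (h3.trans h4.symm) hef
          · obtain ⟨q, hq, hrq, hqu⟩ := hK.exists_prev hrs
            have hrv : G.Adj r v := by
              rcases Finset.mem_insert.1 (hno e heU hre) with rfl | h1
              · exact hre
              rcases Finset.mem_insert.1 (hno f hfU hrf) with rfl | h2
              · exact hrf
              exact absurd ((hqu e h1 hre).trans (hqu f h2 hrf).symm) hef
            exact (hvn r (hC.1 hrC) hrv.symm).resolve_left hrs
        have hcl' : IsClosedIn G U (insert v K) := by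
          refine ⟨Finset.insert_subset (hC.1 hv)
            (hKC.trans ((Finset.erase_subset _ _).trans hC.1)), ?_⟩
          intro u hu w hw huw
          rcases Finset.mem_insert.1 hu with rfl | hu'
          · rcases hvn w hw huw with rfl | rfl
            · exact Finset.mem_insert_of_mem hK.mem.1
            · exact Finset.mem_insert_of_mem (hrt ▸ hK.mem.2)
          · by_cases hur : u = r
            · subst hur; exact hno w hw huw
            · exact hcl u hu' hur w hw huw
        have heq := hmin _ (Finset.insert_subset hv (hKC.trans (Finset.erase_subset _ _))) hcl'
          (Finset.mem_insert_self _ _)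
        apply hcon
        rw [← heq, Finset.erase_insert fun h => (Finset.mem_erase.1 (hKC h)).1 rfl, ← hrt]
        exact hK
      obtain ⟨w, hwU, hrw, hw⟩ := hout
      rw [Finset.mem_insert, not_or] at hw
      refine ⟨insert w K, w, .cons hK hw.2 fun u hu => ⟨fun h => ?_, ?_⟩, ?_, ?_, ?_⟩
      · by_contra hur
        have := hcl u hu hur w hwU h.symm
        simp [hw] at this
      · rintro rfl; exact hrw.symm
      · refine Finset.insert_subset ?_ hKC
        exact Finset.mem_erase.2 ⟨hw.1, hC.2 r hrC w hwU hrw⟩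
      · intro u hu huw z hz huz
        have hu' := (Finset.mem_insert.1 hu).resolve_left huw
        by_cases hur : u = r
        · subst hur
          obtain ⟨w₀, hw₀, hrw₀⟩ := hprev
          have hw₀U : w₀ ∈ U := by
            rcases Finset.mem_insert.1 hw₀ with rfl | h
            · exact hC.1 hv
            · exact hC.1 (Finset.mem_of_mem_erase (hKC h))
          have hne : w₀ ≠ w := by
            rintro rfl
            simp [hw] at hw₀
          have hz' : z = w₀ ∨ z = w := by
            have h1 := hrn z hz huz
            have h2 := hrn w₀ hw₀U hrw₀
            have h3 := hrn w hwU hrw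
            grind
          rcases hz' with rfl | rfl
          · grind
          · grind
        · have := hcl u hu' hur z hz huz
          grind
      · rw [Finset.card_insert_of_notMem hw.2]; omega
  obtain ⟨K, r, -, hK, -, hn⟩ := main C.card
  have := Finset.card_le_card (hK.trans (Finset.erase_subset _ _))
  omega

/-! ### Drawing a path and a cycle -/

/-- A path with prescribed abscissas is drawn upwards with diagonal edges. -/
theorem InducedPath.exists_drawn {s t : V} {K : Finset V} (h : InducedPath G s K t) {x : V → ℝ}
    (hx : Set.InjOn x K) :
    ∃ Y : V → ℝ, Drawn G K x Y ∧ (∀ u ∈ K, u ≠ t → Y u < Y t) ∧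
      (∀ u ∈ K, Y u - Y s ∈ Submodule.span ℚ (x '' K)) ∧
      (t ≠ s → ∃ σ : ℝ, (σ = 1 ∨ σ = -1) ∧
        ∀ u ∈ K, u ≠ s → -(Y u - Y s) < σ * (x u - x s)) := by
  induction h with
  | single =>
    refine ⟨0, Drawn.singleton _ _ _, ?_, ?_, fun h => absurd rfl h⟩
    · intro u hu hne; exact absurd (Finset.mem_singleton.1 hu) hne
    · intro u hu; simp
  | @cons K t v h hv ha ih =>
    obtain ⟨Y, hD, htop, hspan, hside⟩ := ih (hx.mono (by simp))
    have htK := h.mem.2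
    have hsK := h.mem.1
    have hvt : v ≠ t := fun e => hv (e ▸ htK)
    have hvs : v ≠ s := fun e => hv (e ▸ hsK)
    have hxne : x v ≠ x t := fun e =>
      hvt (hx (by simp) (by simp [htK]) e)
    have hpos : 0 < |x v - x t| := abs_pos.2 (sub_ne_zero.2 hxne)
    have hY : ∀ u ∈ K, Function.update Y v (Y t + |x v - x t|) u = Y u := fun u hu =>
      Function.update_of_ne (by rintro rfl; exact hv hu) _ _
    have hYv : Function.update Y v (Y t + |x v - x t|) v = Y t + |x v - x t| :=
      Function.update_self _ _ _
    have hle : ∀ u ∈ K, Y u ≤ Y t := fun u hu => by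
      by_cases e : u = t
      · rw [e]
      · exact (htop u hu e).le
    have hsub : Submodule.span ℚ (x '' K) ≤ Submodule.span ℚ (x '' (insert v K : Finset V)) :=
      Submodule.span_mono (Set.image_mono (by simp))
    refine ⟨Function.update Y v (Y t + |x v - x t|), ?_, ?_, ?_, ?_⟩
    · refine (hD.congr (fun _ _ => rfl) hY).insert_top htK ?_ hxne ?_ ?_
      · intro u hu; rw [hY u hu, hY t htK]; exact hle u hu
      · rw [hYv, hY t htK]
      · intro u hu huv; exact Or.inl ((ha u hu).1 huv)
    · intro u hu huv
      have hu' := (Finset.mem_insert.1 hu).resolve_left huv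
      rw [hYv, hY u hu']
      linarith [hle u hu']
    · intro u hu
      rw [hY s hsK]
      rcases Finset.mem_insert.1 hu with rfl | hu'
      · rw [hYv]
        have h1 : x u ∈ Submodule.span ℚ (x '' (insert u K : Finset V)) :=
          Submodule.subset_span ⟨u, by simp, rfl⟩
        have h2 : x t ∈ Submodule.span ℚ (x '' (insert u K : Finset V)) :=
          Submodule.subset_span ⟨t, by simp [htK], rfl⟩
        have h3 : |x u - x t| ∈ Submodule.span ℚ (x '' (insert u K : Finset V)) := by
          rcases abs_choice (x u - x t) with h | h <;> rw [h]
          · exact Submodule.sub_mem _ h1 h2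
          · exact Submodule.neg_mem _ (Submodule.sub_mem _ h1 h2)
        have h4 := Submodule.add_mem _ (hsub (hspan t htK)) h3
        convert h4 using 1; ring
      · rw [hY u hu']; exact hsub (hspan u hu')
    · intro _
      -- The quantity `Y u + σ * x u` strictly increases along the first edge, by the choice of `σ`,
      -- and never decreases along a later upward diagonal. So the path stays strictly on one side
      -- of a diagonal line through `s`.
      by_cases hts : t = s
      · subst hts
        have hK := h.eq_singleton
        rcases lt_or_gt_of_ne hxne with hlt | hlt
        · refine ⟨-1, Or.inr rfl, fun u hu hut => ?_⟩
          have huv : u = v := by rw [hK] at hu; simpa [hut] using hu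
          subst huv
          rw [hYv, hY t htK]; linarith
        · refine ⟨1, Or.inl rfl, fun u hu hut => ?_⟩
          have huv : u = v := by rw [hK] at hu; simpa [hut] using hu
          subst huv
          rw [hYv, hY t htK]; linarith
      · obtain ⟨σ, hσ, hσ'⟩ := hside hts
        refine ⟨σ, hσ, fun u hu hus => ?_⟩
        rw [hY s hsK]
        rcases Finset.mem_insert.1 hu with rfl | hu₁
        · rw [hYv]
          have h1 := hσ' t htK hts
          have h2 : -|x u - x t| ≤ σ * (x u - x t) := by
            rcases hσ with rfl | rfl
            · rw [one_mul]; exact neg_abs_le _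
            · linarith [le_abs_self (x u - x t)]
          linarith
        · rw [hY u hu₁]; exact hσ' u hu₁ hus

/-- A cycle component can be drawn with prescribed abscissas of all vertices but one, and with this
one as a highest vertex and to the left (`σ = 1`) or to the right (`σ = -1`) of all the others. -/
theorem exists_cycle_drawn {U K : Finset V} {v : V} (hK : IsClosedIn G U K) (hv : v ∈ K)
    (hdg : ∀ u ∈ K, dg G U u = 2) :
    ∃ C ⊆ K, IsClosedIn G U C ∧ v ∈ C ∧ ∀ x : V → ℝ, Set.InjOn x (C.erase v) →
      ∃ (X Y : V → ℝ) (σ : ℝ), (σ = 1 ∨ σ = -1) ∧ Drawn G C X Y ∧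
        (∀ u ∈ C, u ≠ v → X u = x u) ∧ (∀ u ∈ C, Y u ≤ Y v) ∧
        (∀ u ∈ C, u ≠ v → σ * X v < σ * X u) ∧
        X v ∈ Submodule.span ℚ (x '' (C.erase v)) := by
  obtain ⟨C, hCK, hC, hvC, hmin⟩ := hK.exists_minimal hv
  refine ⟨C, hCK, hC, hvC, fun x hx => ?_⟩
  obtain ⟨s, t, hst, hP, hn⟩ := exists_inducedPath_erase hC hvC (fun u hu => hdg u (hCK hu)) hmin
  obtain ⟨Y, hD, htop, hspan, hside⟩ := hP.exists_drawn hx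
  obtain ⟨σ, hσ, hσ'⟩ := hside hst.symm
  have hsK := hP.mem.1
  have htK := hP.mem.2
  have hσσ : σ * σ = 1 := by rcases hσ with rfl | rfl <;> norm_num
  -- The free diagonal ray from `s` meets the horizontal line through the highest vertex `t` at this
  -- abscissa, and `v` goes there.
  set ξ := x s - σ * (Y t - Y s) with hξ
  have hL := htop s hsK hst
  have hle : ∀ u ∈ C.erase v, Y u ≤ Y t := fun u hu => by
    by_cases e : u = t
    · rw [e]
    · exact (htop u hu e).le
  have hX : ∀ u ∈ C.erase v, Function.update x v ξ u = x u := fun u hu =>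
    Function.update_of_ne (Finset.ne_of_mem_erase hu) _ _
  have hY : ∀ u ∈ C.erase v, Function.update Y v (Y t) u = Y u := fun u hu =>
    Function.update_of_ne (Finset.ne_of_mem_erase hu) _ _
  have hXv : Function.update x v ξ v = ξ := Function.update_self _ _ _
  have hYv : Function.update Y v (Y t) v = Y t := Function.update_self _ _ _
  have hleft : ∀ u ∈ C.erase v, σ * ξ < σ * x u := by
    intro u hu
    have h1 : σ * ξ = σ * x s - (Y t - Y s) := by
      rw [hξ, mul_sub, ← mul_assoc, hσσ, one_mul]
    by_cases hus : u = s
    · subst hus; linarith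
    · have := hσ' u hu hus
      have := hle u hu
      linarith
  refine ⟨Function.update x v ξ, Function.update Y v (Y t), σ, hσ, ?_, ?_, ?_, ?_, ?_⟩
  · rw [← Finset.insert_erase hvC]
    refine (hD.congr hX hY).insert_extreme (σ := σ) ?_ ?_ ?_
    · intro u hu; rw [hXv, hX u hu]; exact hleft u hu
    · intro u hu huv
      rcases (hn u (Finset.mem_of_mem_erase hu)).1 huv with rfl | rfl
      · right; right
        rw [hXv, hX u hu, hYv, hY u hu, hξ,
          show x u - σ * (Y t - Y u) - x u = -σ * (Y t - Y u) by ring, abs_mul]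
        rcases hσ with rfl | rfl <;> simp
      · right; left
        rw [hYv, hY u hu]
    · intro u hu huv w hw hwu r h0 h1 hxw hyw
      rw [hXv, hX u hu, hX w hw] at hxw
      rw [hYv, hY u hu, hY w hw] at hyw
      rcases (hn u (Finset.mem_of_mem_erase hu)).1 huv with rfl | rfl
      · have h2 := hσ' w hw hwu
        have h3 : σ * (x w - x u) = -(Y w - Y u) := by
          rw [hxw, hyw, hξ]
          linear_combination (-(1 - r) * (Y t - Y u)) * hσσ
        linarith
      · have := htop w hw hwu
        rw [hyw] at this
        linarith
  · intro u hu huv; exact hX u (Finset.mem_erase.2 ⟨huv, hu⟩)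
  · intro u hu
    rw [hYv]
    by_cases huv : u = v
    · rw [huv, hYv]
    · have hu' := Finset.mem_erase.2 ⟨huv, hu⟩
      rw [hY u hu']; exact hle u hu'
  · intro u hu huv
    have hu' := Finset.mem_erase.2 ⟨huv, hu⟩
    rw [hXv, hX u hu']; exact hleft u hu'
  · rw [hXv, hξ]
    have h1 : x s ∈ Submodule.span ℚ (x '' (C.erase v)) := Submodule.subset_span ⟨s, hsK, rfl⟩
    have h2 := hspan t htK
    rcases hσ with h | h <;> rw [h]
    · rw [one_mul]; exact Submodule.sub_mem _ h1 h2
    · rw [neg_one_mul, sub_neg_eq_add]; exact Submodule.add_mem _ h1 h2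

/-! ### Generic abscissas -/

/-- The rational span of finitely many reals is countable, so its complement in ℝ survives the
removal of one more point. -/
theorem exists_notMem_span {P : Set V} (hP : P.Finite) (x : V → ℝ) (z : ℝ) :
    ∃ ξ : ℝ, ξ ∉ Submodule.span ℚ (x '' P) ∧ ξ ≠ z := by
  have : Countable (Submodule.span ℚ (x '' P)) := by
    have := hP.to_subtype
    rw [Set.image_eq_range]
    infer_instance
  have hc : ((Submodule.span ℚ (x '' P) : Set ℝ) ∪ {z}).Countable :=
    (Set.to_countable (Submodule.span ℚ (x '' P) : Set ℝ)).union (Set.countable_singleton z)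
  obtain ⟨ξ, hξ⟩ := (hc.dense_compl ℝ).nonempty
  refine ⟨ξ, fun h => hξ (Or.inl h), fun h => hξ (Or.inr h)⟩

theorem linearIndepOn_update {P : Set V} {x : V → ℝ} (hx : LinearIndepOn ℚ x P) {b : V}
    (hb : b ∉ P) {ξ : ℝ} (hξ : ξ ∉ Submodule.span ℚ (x '' P)) :
    LinearIndepOn ℚ (Function.update x b ξ) (insert b P) := by
  have heq : Set.EqOn x (Function.update x b ξ) P := fun u hu =>
    (Function.update_of_ne (by rintro rfl; exact hb hu) _ _).symm
  refine (hx.congr heq).insert ?_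
  rwa [← heq.image_eq, Function.update_self]

theorem ne_of_mem_span_image {P : Set V} {x : V → ℝ} (hx : LinearIndepOn ℚ x P) {Q : Set V}
    (hQ : Q ⊆ P) {d : V} (hd : d ∈ P) (hdQ : d ∉ Q) {r : ℝ}
    (hr : r ∈ Submodule.span ℚ (x '' Q)) : r ≠ x d := by
  rintro rfl
  refine hx.notMem_span hd (Submodule.span_mono (Set.image_mono ?_) hr)
  exact Set.subset_sdiff_singleton hQ hdQ

/-! ### Drawings with prescribed abscissas -/

/-- A drawing of `G[U]` in which the vertices in `P` have the abscissas given by `x` and no vertex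
is to the north of a vertex in `P`. -/
structure Fits (G : SimpleGraph V) (U : Finset V) (P : Set V) (x X Y : V → ℝ) : Prop where
  drawn : Drawn G U X Y
  eq : ∀ d ∈ P, X d = x d
  free : ∀ d ∈ P, NorthFree U X Y d

/-- A vertex above everything else can spoil northward freedom only on its own vertical line. The
prescribed vertices on that line are the ones that it may be joined to vertically. -/
theorem Fits.insert_top {S : Finset V} {P : Set V} {x X Y : V → ℝ} (h : Fits G S P x X Y)
    (hPS : P ⊆ S) {a v : V} {ξ : ℝ} (ha : a ∈ S) (htop : ∀ u ∈ S, Y u ≤ Y a) (hv : v ∉ S)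
    (hξ : ξ ≠ X a)
    (hnb : ∀ u ∈ S, G.Adj v u → u = a ∨ (u ∈ P ∧ x u = ξ)) :
    ∃ X' Y' : V → ℝ, (∀ u ∈ S, X' u = X u) ∧ (∀ u ∈ S, Y' u = Y u) ∧ X' v = ξ ∧
      Y' v = Y a + |ξ - X a| ∧
      Drawn G (insert v S) X' Y' ∧ (∀ u ∈ S, Y' u < Y' v) ∧ NorthFree (insert v S) X' Y' v ∧
      ∀ d ∈ P, x d ≠ ξ → NorthFree (insert v S) X' Y' d := by
  have hne : ∀ u ∈ S, u ≠ v := by rintro u hu rfl; exact hv hu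
  have hX : ∀ u ∈ S, Function.update X v ξ u = X u := fun u hu =>
    Function.update_of_ne (hne u hu) _ _
  have hY : ∀ u ∈ S, Function.update Y v (Y a + |ξ - X a|) u = Y u := fun u hu =>
    Function.update_of_ne (hne u hu) _ _
  have hXv : Function.update X v ξ v = ξ := Function.update_self _ _ _
  have hYv : Function.update Y v (Y a + |ξ - X a|) v = Y a + |ξ - X a| :=
    Function.update_self _ _ _
  have hpos : 0 < |ξ - X a| := abs_pos.2 (sub_ne_zero.2 hξ)
  have hlt : ∀ u ∈ S, Y u < Y a + |ξ - X a| := fun u hu => by linarith [htop u hu]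
  refine ⟨_, _, hX, hY, hXv, hYv, ?_, ?_, ?_, ?_⟩
  · refine (h.drawn.congr hX hY).insert_top ha ?_ ?_ ?_ ?_
    · intro u hu; rw [hY u hu, hY a ha]; exact htop u hu
    · rw [hXv, hX a ha]; exact hξ
    · rw [hXv, hYv, hX a ha, hY a ha]
    · intro u hu huv
      rcases hnb u hu huv with h1 | ⟨h1, h2⟩
      · exact Or.inl h1
      · refine Or.inr ⟨?_, (h.free u h1).congr hu hX hY⟩
        rw [hX u hu, hXv, h.eq u h1, h2]
  · intro u hu; rw [hY u hu, hYv]; exact hlt u hu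
  · intro u hu huv _
    have hu' := (Finset.mem_insert.1 hu).resolve_left huv
    rw [hY u hu', hYv]; exact hlt u hu'
  · intro d hd hdξ u hu hud he
    have hdS : d ∈ S := hPS hd
    rcases Finset.mem_insert.1 hu with rfl | hu'
    · rw [hXv, hX d hdS, h.eq d hd] at he
      exact absurd he.symm hdξ
    · exact (h.free d hd).congr hdS hX hY u hu' hud he

theorem exists_add_gt (C : Finset V) (Y : V → ℝ) (B : ℝ) : ∃ c : ℝ, ∀ v ∈ C, B < Y v + c := by
  obtain ⟨m, hm⟩ := (C.image Y).bddBelow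
  refine ⟨B - m + 1, fun v hv => ?_⟩
  have := hm (Finset.mem_coe.2 (Finset.mem_image_of_mem Y hv))
  linarith

theorem exists_gt_all (C : Finset V) (Y : V → ℝ) : ∃ B : ℝ, ∀ v ∈ C, Y v < B := by
  obtain ⟨m, hm⟩ := (C.image Y).bddAbove
  refine ⟨m + 1, fun v hv => ?_⟩
  have := hm (Finset.mem_coe.2 (Finset.mem_image_of_mem Y hv))
  linarith

/-- The drawing `(X₂, Y₂)` of a cycle component has the properties stated in
`exists_cycle_drawn`. -/
structure CycleDrawn (G : SimpleGraph V) (C : Finset V) (b : V) (x X Y : V → ℝ) (σ : ℝ) : Prop where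
  sign : σ = 1 ∨ σ = -1
  drawn : Drawn G C X Y
  eq : ∀ u ∈ C, u ≠ b → X u = x u
  top : ∀ u ∈ C, Y u ≤ Y b
  side : ∀ u ∈ C, u ≠ b → σ * X b < σ * X u
  span : X b ∈ Submodule.span ℚ (x '' (C.erase b))

/-- Only `u = b` needs an argument. Inside the cycle `b` is strictly extreme; outside it, `X b` is a
rational combination of abscissas independent of `x d`. Thus a cycle placed above the rest never
lies over a prescribed vertex of the rest. -/
theorem CycleDrawn.ne_of_ne {C : Finset V} {b : V} {x X Y : V → ℝ} {σ : ℝ}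
    (h : CycleDrawn G C b x X Y σ) {P : Set V} (hx : LinearIndepOn ℚ x P) (hb : b ∉ P)
    (hCP : ∀ u ∈ C, u ≠ b → u ∈ P) {u d : V} (hu : u ∈ C) (hd : d ∈ P) (hne : u ≠ d) :
    X u ≠ x d := by
  by_cases hub : u = b
  · subst hub
    by_cases hdC : d ∈ C
    · intro he
      have := h.side d hdC hne.symm
      rw [h.eq d hdC hne.symm, he] at this
      exact lt_irrefl _ this
    · refine ne_of_mem_span_image hx (Q := (C.erase u : Finset V)) ?_ hd ?_ h.span
      · intro q hq
        have hq := Finset.mem_erase.1 (Finset.mem_coe.1 hq)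
        exact hCP q hq.2 hq.1
      · intro hd'; exact hdC (Finset.mem_of_mem_erase (Finset.mem_coe.1 hd'))
  · rw [h.eq u hu hub]
    intro he
    exact hne (hx.injOn (hCP u hu hub) hd he)

/-- A cycle component is drawn above the rest. -/
theorem Fits.cycle_above {U C : Finset V} {P : Set V} {x X₁ Y₁ X₂ Y₂ : V → ℝ} {b : V} {σ : ℝ}
    (hC : IsClosedIn G U C) (hx : LinearIndepOn ℚ x P) (hPU : P ⊆ U) (hb : b ∉ P)
    (hCP : ∀ u ∈ C, u ≠ b → u ∈ P)
    (h₁ : Fits G (U \ C) (P \ C) x X₁ Y₁) (h₂ : CycleDrawn G C b x X₂ Y₂ σ) :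
    ∃ X Y : V → ℝ, (∀ u ∈ U \ C, X u = X₁ u ∧ Y u = Y₁ u) ∧ (∀ u ∈ C, X u = X₂ u) ∧
      (∀ u ∈ C, ∀ v ∈ C, Y u - Y v = Y₂ u - Y₂ v) ∧ (∀ u ∈ U \ C, ∀ v ∈ C, Y u < Y v) ∧
      ∀ M : ℝ, 0 ≤ M → Fits G U P x X (fun v => if v ∈ C then Y v + M else Y v) := by
  obtain ⟨B, hB⟩ := exists_gt_all (U \ C) Y₁
  obtain ⟨c, hc⟩ := exists_add_gt C Y₂ B
  have hX₁ : ∀ u ∈ U \ C, C.piecewise X₂ X₁ u = X₁ u := fun u hu =>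
    Finset.piecewise_eq_of_notMem _ _ _ (Finset.mem_sdiff.1 hu).2
  have hX₂ : ∀ u ∈ C, C.piecewise X₂ X₁ u = X₂ u := fun u hu =>
    Finset.piecewise_eq_of_mem _ _ _ hu
  have hY₁ : ∀ u ∈ U \ C, C.piecewise (fun v => Y₂ v + c) Y₁ u = Y₁ u := fun u hu =>
    Finset.piecewise_eq_of_notMem _ _ _ (Finset.mem_sdiff.1 hu).2
  have hY₂ : ∀ u ∈ C, C.piecewise (fun v => Y₂ v + c) Y₁ u = Y₂ u + c := fun u hu =>
    Finset.piecewise_eq_of_mem _ _ _ hu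
  refine ⟨C.piecewise X₂ X₁, C.piecewise (fun v => Y₂ v + c) Y₁,
    fun u hu => ⟨hX₁ u hu, hY₁ u hu⟩, hX₂, ?_, ?_, ?_⟩
  · intro u hu v hv
    rw [hY₂ u hu, hY₂ v hv]; ring
  · intro u hu v hv
    rw [hY₁ u hu, hY₂ v hv]
    exact (hB u hu).trans (hc v hv)
  intro M hM
  set X := C.piecewise X₂ X₁
  set Y := fun v => if v ∈ C then C.piecewise (fun v => Y₂ v + c) Y₁ v + M
    else C.piecewise (fun v => Y₂ v + c) Y₁ v with hYdef
  have hY₁' : ∀ u ∈ U \ C, Y u = Y₁ u := fun u hu => by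
    rw [hYdef]; simp only [if_neg (Finset.mem_sdiff.1 hu).2]; exact hY₁ u hu
  have hY₂' : ∀ u ∈ C, Y u = Y₂ u + (c + M) := fun u hu => by
    rw [hYdef]; simp only [if_pos hu]; rw [hY₂ u hu]; ring
  have hlt : ∀ u ∈ U \ C, ∀ v ∈ C, Y u < Y v := fun u hu v hv => by
    rw [hY₁' u hu, hY₂' v hv]
    linarith [hB u hu, hc v hv]
  have hXP : ∀ d ∈ P, X d = x d := by
    intro d hd
    by_cases hdC : d ∈ C
    · rw [hX₂ d hdC]; exact h₂.eq d hdC (by rintro rfl; exact hb hd)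
    · rw [hX₁ d (Finset.mem_sdiff.2 ⟨hPU hd, hdC⟩)]; exact h₁.eq d ⟨hd, hdC⟩
  refine ⟨?_, hXP, ?_⟩
  · rw [← Finset.sdiff_union_of_subset hC.1]
    refine (h₁.drawn.congr hX₁ hY₁').stack ((h₂.drawn.shift (c + M)).congr hX₂ hY₂') hlt ?_
    intro u hu v hv huv
    exact absurd (hC.2 v hv u (Finset.mem_sdiff.1 hu).1 huv.symm) (Finset.mem_sdiff.1 hu).2
  · intro d hd u hu hud he
    rw [hXP d hd] at he
    by_cases huC : u ∈ C
    · rw [hX₂ u huC] at he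
      exact absurd he (h₂.ne_of_ne hx hb hCP huC hd hud)
    · have hu' := Finset.mem_sdiff.2 ⟨hu, huC⟩
      by_cases hdC : d ∈ C
      · exact hlt u hu' d hdC
      · have hd' := Finset.mem_sdiff.2 ⟨hPU hd, hdC⟩
        refine (h₁.free d ⟨hd, hdC⟩).congr hd' hX₁ hY₁' u hu' hud ?_
        rw [he, hXP d hd]

/-- A cycle that is joined by the single edge `db` to the rest is drawn above the rest, if `d` is
a highest vertex of the rest. -/
theorem Fits.cycle_on_top {U C : Finset V} {P : Set V} {x X₁ Y₁ X₂ Y₂ : V → ℝ} {b d : V} {σ : ℝ}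
    (hCU : C ⊆ U) (hC : ∀ u ∈ C, ∀ v ∈ U \ C, G.Adj u v → u = b ∧ v = d)
    (hbC : b ∈ C) (hd : d ∈ U \ C) (hdP : d ∈ P)
    (hx : LinearIndepOn ℚ x P) (hPU : P ⊆ U) (hb : b ∉ P)
    (hCP : ∀ u ∈ C, u ≠ b → u ∈ P)
    (h₁ : Fits G (U \ C) (P \ C) x X₁ Y₁) (htop : ∀ u ∈ U \ C, Y₁ u ≤ Y₁ d)
    (h₂ : CycleDrawn G C b x X₂ Y₂ σ) :
    ∃ X Y : V → ℝ, Fits G U P x X Y := by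
  have hdC := (Finset.mem_sdiff.1 hd).2
  have hX₁d : X₁ d = x d := h₁.eq d ⟨hdP, hdC⟩
  have hne : X₂ b ≠ x d := h₂.ne_of_ne hx hb hCP hbC hdP (by rintro rfl; exact hdC hbC)
  have hpos : 0 < |X₂ b - x d| := abs_pos.2 (sub_ne_zero.2 hne)
  -- Upside down, the cycle has `b` as a lowest vertex; this shift puts `b` exactly as far above `d`
  -- as it is beside it.
  set c := Y₂ b + Y₁ d + |X₂ b - x d| with hc
  have hX₁ : ∀ u ∈ U \ C, C.piecewise X₂ X₁ u = X₁ u := fun u hu =>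
    Finset.piecewise_eq_of_notMem _ _ _ (Finset.mem_sdiff.1 hu).2
  have hX₂ : ∀ u ∈ C, C.piecewise X₂ X₁ u = X₂ u := fun u hu =>
    Finset.piecewise_eq_of_mem _ _ _ hu
  have hY₁ : ∀ u ∈ U \ C, C.piecewise (fun v => - Y₂ v + c) Y₁ u = Y₁ u := fun u hu =>
    Finset.piecewise_eq_of_notMem _ _ _ (Finset.mem_sdiff.1 hu).2
  have hY₂ : ∀ u ∈ C, C.piecewise (fun v => - Y₂ v + c) Y₁ u = - Y₂ u + c := fun u hu =>
    Finset.piecewise_eq_of_mem _ _ _ hu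
  have hlt : ∀ u ∈ U \ C, ∀ v ∈ C, C.piecewise (fun v => - Y₂ v + c) Y₁ u <
      C.piecewise (fun v => - Y₂ v + c) Y₁ v := fun u hu v hv => by
    rw [hY₁ u hu, hY₂ v hv]
    linarith [htop u hu, h₂.top v hv]
  have hXP : ∀ d ∈ P, C.piecewise X₂ X₁ d = x d := by
    intro d hd
    by_cases hdC : d ∈ C
    · rw [hX₂ d hdC]; exact h₂.eq d hdC (by rintro rfl; exact hb hd)
    · rw [hX₁ d (Finset.mem_sdiff.2 ⟨hPU hd, hdC⟩)]; exact h₁.eq d ⟨hd, hdC⟩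
  refine ⟨C.piecewise X₂ X₁, C.piecewise (fun v => - Y₂ v + c) Y₁, ?_, hXP, ?_⟩
  · rw [← Finset.sdiff_union_of_subset hCU]
    refine (h₁.drawn.congr hX₁ hY₁).stack ((h₂.drawn.flip.shift c).congr hX₂ hY₂) hlt ?_
    intro u hu v hv huv
    obtain ⟨rfl, rfl⟩ := hC v hv u hu huv.symm
    right
    refine ⟨?_, ?_, ?_⟩
    · rw [hX₁ u hu, hX₂ v hv, hY₁ u hu, hY₂ v hv, hX₁d, abs_sub_comm,
        show Y₁ u - (- Y₂ v + c) = -|X₂ v - x u| by rw [hc]; ring, abs_neg, abs_abs]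
    · intro w hw; rw [hY₁ u hu, hY₁ w hw]; exact htop w hw
    · intro w hw; rw [hY₂ v hv, hY₂ w hw]; linarith [h₂.top w hw]
  · intro d hd u hu hud he
    rw [hXP d hd] at he
    by_cases huC : u ∈ C
    · rw [hX₂ u huC] at he
      exact absurd he (h₂.ne_of_ne hx hb hCP huC hd hud)
    · have hu' := Finset.mem_sdiff.2 ⟨hu, huC⟩
      by_cases hdC : d ∈ C
      · exact hlt u hu' d hdC
      · have hd' := Finset.mem_sdiff.2 ⟨hPU hd, hdC⟩
        refine (h₁.free d ⟨hd, hdC⟩).congr hd' hX₁ hY₁ u hu' hud ?_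
        rw [he, hXP d hd]

/-- `G[U]` has a drawing that consists of a lower part with a highest vertex `a` and of an upper
part `H` with a highest vertex `b`, and the upper part may be moved upwards. -/
def SplitFits (G : SimpleGraph V) (U : Finset V) (a b : V) (P : Set V) (x : V → ℝ) (z : ℝ) : Prop :=
  ∃ (H : Finset V) (X Y : V → ℝ) (σ : ℝ), H ⊆ U ∧ (σ = 1 ∨ σ = -1) ∧ a ∈ U \ H ∧ b ∈ H ∧
    (∀ M : ℝ, 0 ≤ M → Fits G U P x X (fun v => if v ∈ H then Y v + M else Y v)) ∧
    (∀ u ∈ U \ H, Y u ≤ Y a) ∧ (∀ u ∈ H, Y u ≤ Y b) ∧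
    (∀ u ∈ H, u ≠ b → Y u = Y b → σ * X b < σ * X u) ∧
    (∀ u ∈ U \ H, ∀ v ∈ H, Y u < Y v) ∧ X b ≠ z

/-- A vertex `d` with the neighbours `a` and `b` is added far to the left or to the right. -/
theorem SplitFits.insert_far {U : Finset V} {a b d : V} {P : Set V} {x : V → ℝ} {z z' : ℝ}
    (h : SplitFits G U a b P x z') (hPU : P ⊆ U) (hd : d ∉ U)
    (hnb : ∀ u ∈ U, G.Adj d u → u = a ∨ u = b) :
    ∃ X Y : V → ℝ, Fits G (insert d U) P x X Y ∧ (∀ u ∈ insert d U, Y u ≤ Y d) ∧ X d ≠ z := by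
  obtain ⟨H, X, Y, σ, hHU, hσ, ha, hb, hfit, hta, htb, hside, hlt, -⟩ := h
  have haU := (Finset.mem_sdiff.1 ha).1
  have haH := (Finset.mem_sdiff.1 ha).2
  have hbU := hHU hb
  have hσσ : σ * σ = 1 := by rcases hσ with rfl | rfl <;> norm_num
  obtain ⟨B₁, hB₁⟩ := exists_gt_all U (fun v => |X v|)
  obtain ⟨B₂, hB₂⟩ := exists_gt_all U (fun v => |Y v|)
  have hB₁0 : 0 < B₁ := (abs_nonneg _).trans_lt (hB₁ a haU)
  have hB₂0 : 0 < B₂ := (abs_nonneg _).trans_lt (hB₂ a haU)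
  -- Large enough for four purposes: the lift `M` is nonnegative, `d` lies beyond all of `U`, the
  -- diagonal from `a` has passed all of `U` sideways when it reaches the heights of the upper part,
  -- and the abscissa of `d` differs from `z`.
  set N := 2 * B₁ + 2 * B₂ + |z| + 1 with hN
  have hzN : |z| < N := by linarith
  have hσX : ∀ u ∈ U, -B₁ < σ * X u ∧ σ * X u < B₁ := fun u hu => by
    have := abs_lt.1 (hB₁ u hu)
    rcases hσ with rfl | rfl <;> constructor <;> linarith
  have hYb : ∀ u ∈ U, -B₂ < Y u ∧ Y u < B₂ := fun u hu => abs_lt.1 (hB₂ u hu)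
  have hab : Y a < Y b := hlt a ha b hb
  -- the height of `b` above `a` is the horizontal distance of `d` from `a`
  set M := N + σ * X a - (Y b - Y a) with hM
  have hz0 := abs_nonneg z
  have hM0 : 0 ≤ M := by
    have h1 := hσX a haU
    have h2 := hYb a haU
    have h3 := hYb b hbU
    linarith
  set Y' := fun v => if v ∈ H then Y v + M else Y v with hY'
  have hF : Fits G U P x X Y' := hfit M hM0
  have hYH : ∀ u ∈ H, Y' u = Y u + M := fun u hu => by simp [hY', hu]
  have hYL : ∀ u ∈ U, u ∉ H → Y' u = Y u := fun u _ hu => by simp [hY', hu]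
  have hne : ∀ u ∈ U, u ≠ d := by rintro u hu rfl; exact hd hu
  set ξ := -σ * N with hξ
  have hσξ : σ * ξ = -N := by rw [hξ]; linear_combination (-N) * hσσ
  have hX₁ : ∀ u ∈ U, Function.update X d ξ u = X u := fun u hu =>
    Function.update_of_ne (hne u hu) _ _
  have hY₁ : ∀ u ∈ U, Function.update Y' d (Y b + M) u = Y' u := fun u hu =>
    Function.update_of_ne (hne u hu) _ _
  have hXd : Function.update X d ξ d = ξ := Function.update_self _ _ _
  have hYd : Function.update Y' d (Y b + M) d = Y b + M := Function.update_self _ _ _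
  have hleft : ∀ u ∈ U, σ * ξ < σ * X u := fun u hu => by
    have := (hσX u hu).1
    rw [hσξ]; linarith
  have hle : ∀ u ∈ U, Y' u ≤ Y b + M := by
    intro u hu
    by_cases huH : u ∈ H
    · rw [hYH u huH]; linarith [htb u huH]
    · rw [hYL u hu huH]
      have := hta u (Finset.mem_sdiff.2 ⟨hu, huH⟩)
      linarith
  refine ⟨Function.update X d ξ, Function.update Y' d (Y b + M), ⟨?_, ?_, ?_⟩, ?_, ?_⟩
  · refine (hF.drawn.congr hX₁ hY₁).insert_extreme (σ := σ) ?_ ?_ ?_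
    · intro u hu; rw [hXd, hX₁ u hu]; exact hleft u hu
    · intro u hu huv
      rcases hnb u hu huv with rfl | rfl
      · right; right
        rw [hXd, hYd, hX₁ u hu, hY₁ u hu, hYL u hu haH]
        have h1 : ξ - X u = -σ * (Y b + M - Y u) := by
          rw [hM, hξ]; linear_combination (X u) * hσσ
        rw [h1, abs_mul]
        rcases hσ with rfl | rfl <;> simp
      · right; left
        rw [hYd, hY₁ u hu, hYH u hb]
    · intro u hu huv w hw hwu t h0 h1 hxw hyw
      rw [hXd, hX₁ u hu, hX₁ w hw] at hxw
      rw [hYd, hY₁ u hu, hY₁ w hw] at hyw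
      have hσw : σ * X w = -N + t * (σ * X u + N) := by
        rw [hxw]; linear_combination (1 - t) * hσξ
      rcases hnb u hu huv with rfl | rfl
      · rw [hYL u hu haH] at hyw
        have hlen : Y b + M - Y u = N + σ * X u := by rw [hM]; ring
        -- The diagonal edge to the lower part: at the heights of `H` it is already beyond every
        -- vertex of `H`, and it leaves the lower part at a highest vertex.
        by_cases hwH : w ∈ H
        · rw [hYH w hwH] at hyw
          have h2 := hσX w hw
          have h3 := hYb w hw
          have h4 := hYb b hbU
          have h5 : σ * X w = -N + (Y b - Y w) := by
            rw [hσw]; linear_combination hyw - t * hlen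
          linarith
        · rw [hYL w hw hwH] at hyw
          have h2 := hta w (Finset.mem_sdiff.2 ⟨hw, hwH⟩)
          have h3 : 0 < N + σ * X u := by linarith [(hσX u hu).1]
          have h4 : Y w = Y u + (1 - t) * (N + σ * X u) := by
            rw [hyw]; linear_combination (1 - t) * hlen
          have h5 : t = 1 := by
            by_contra hne'
            have : 0 < 1 - t := by
              have := lt_of_le_of_ne h1 hne'
              linarith
            have := mul_pos this h3
            linarith
          subst h5
          apply hwu
          refine hF.drawn.inj w hw u hu (by linarith) ?_
          rw [hYL w hw hwH, hYL u hu haH]; linarith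
      · rw [hYH u hb] at hyw
        have hyw' : Y' w = Y u + M := by rw [hyw]; ring
        -- The horizontal edge to the upper part: the lower part does not reach this height, and
        -- vertices of `H` at this height lie behind the end of the edge.
        by_cases hwH : w ∈ H
        · rw [hYH w hwH] at hyw'
          have h2 := hside w hwH hwu (by linarith)
          have h3 : 0 < σ * X u + N := by linarith [(hσX u hu).1]
          nlinarith
        · rw [hYL w hw hwH] at hyw'
          have := hta w (Finset.mem_sdiff.2 ⟨hw, hwH⟩)
          linarith
  · intro e he
    rw [hX₁ e (hPU he)]; exact hF.eq e he
  · intro e he u hu hue hxe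
    have heU := hPU he
    rcases Finset.mem_insert.1 hu with rfl | hu'
    · rw [hXd, hX₁ e heU] at hxe
      have := hleft e heU
      rw [hxe] at this
      exact absurd this (lt_irrefl _)
    · exact (hF.free e he).congr heU hX₁ hY₁ u hu' hue hxe
  · intro u hu
    rw [hYd]
    rcases Finset.mem_insert.1 hu with rfl | hu'
    · rw [hYd]
    · rw [hY₁ u hu']; exact hle u hu'
  · rw [hXd]
    intro hz
    have h1 : |ξ| = N := by
      have : 0 < N := by linarith
      rw [hξ, abs_mul, abs_of_pos this]
      rcases hσ with h | h <;> rw [h] <;> simp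
    rw [hz] at h1
    linarith

/-! ### The inductive construction -/

/-- The vertices of `G[U]` with prescribed abscissas: those of degree one, and those of degree two
outside `F`. -/
def Presc (G : SimpleGraph V) (U F : Finset V) : Set V :=
  {v | v ∈ U ∧ (dg G U v = 1 ∨ (dg G U v = 2 ∧ v ∉ F))}

/-- `K` contains vertices of degree two and vertices of degree three. -/
def Mixed (G : SimpleGraph V) (U K : Finset V) : Prop :=
  (∃ v ∈ K, dg G U v = 2) ∧ ∃ v ∈ K, dg G U v = 3

theorem presc_subset {U F : Finset V} : Presc G U F ⊆ U := fun _ h => h.1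

theorem presc_finite (U F : Finset V) : (Presc G U F).Finite :=
  U.finite_toSet.subset presc_subset

theorem IsClosedIn.of_erase {U K : Finset V} {d : V} (h : IsClosedIn G (U.erase d) K)
    (hd : ∀ u ∈ K, ¬ G.Adj u d) : IsClosedIn G U K := by
  refine ⟨h.1.trans (Finset.erase_subset _ _), fun u hu v hv huv => h.2 u hu v ?_ huv⟩
  refine Finset.mem_erase.2 ⟨?_, hv⟩
  rintro rfl
  exact hd u hu huv

theorem IsClosedIn.of_sdiff {U C K : Finset V} (hC : IsClosedIn G U C)
    (h : IsClosedIn G (U \ C) K) : IsClosedIn G U K := by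
  refine ⟨h.1.trans Finset.sdiff_subset, fun u hu v hv huv => h.2 u hu v ?_ huv⟩
  have hu' := Finset.mem_sdiff.1 (h.1 hu)
  exact Finset.mem_sdiff.2 ⟨hv, fun hvC => hu'.2 (hC.2 v hvC u hu'.1 huv.symm)⟩

theorem Mixed.congr {U U' K : Finset V} (h : Mixed G U K) (hdg : ∀ v ∈ K, dg G U' v = dg G U v) :
    Mixed G U' K := by
  obtain ⟨⟨v, hv, h2⟩, w, hw, h3⟩ := h
  exact ⟨⟨v, hv, by rw [hdg v hv, h2]⟩, w, hw, by rw [hdg w hw, h3]⟩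

theorem Fits.congr {U : Finset V} {P : Set V} {x X Y X' Y' : V → ℝ} (h : Fits G U P x X Y)
    (hPU : P ⊆ U) (hX : ∀ u ∈ U, X' u = X u) (hY : ∀ u ∈ U, Y' u = Y u) : Fits G U P x X' Y' :=
  ⟨h.drawn.congr hX hY, fun d hd => by rw [hX d (hPU hd)]; exact h.eq d hd,
    fun d hd => (h.free d hd).congr (hPU hd) hX hY⟩

/-- Every vertex of degree two of `G[U]` can have a prescribed abscissa. -/
def Drawable (G : SimpleGraph V) (U : Finset V) : Prop :=
  (∀ v ∈ U, dg G U v = 2 ∨ dg G U v = 3) →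
  (∀ K, IsClosedIn G U K → K.Nonempty → Mixed G U K) →
  ∀ x : V → ℝ, LinearIndepOn ℚ x (Presc G U ∅) → ∃ X Y, Fits G U (Presc G U ∅) x X Y

/-- `G[U]` can be drawn with `a` as a highest vertex. -/
def TopDrawable (G : SimpleGraph V) (U : Finset V) (a : V) : Prop :=
  a ∈ U → (dg G U a = 1 ∨ dg G U a = 2) → (∀ v ∈ U, v ≠ a → dg G U v = 2 ∨ dg G U v = 3) →
  (∀ K, IsClosedIn G U K → K.Nonempty → a ∉ K → Mixed G U K) →
  ∀ x : V → ℝ, LinearIndepOn ℚ x (Presc G U {a}) →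
  ∀ z : ℝ, z ∉ Submodule.span ℚ (x '' Presc G U {a}) →
  ∃ X Y, Fits G U (Presc G U {a}) x X Y ∧ (∀ u ∈ U, Y u ≤ Y a) ∧ X a ≠ z

/-- `G[U]`, with two vertices `a` and `b` of degree one, can be drawn in two parts with the highest
vertices `a` and `b`. -/
def SplitDrawable (G : SimpleGraph V) (U : Finset V) (a b : V) : Prop :=
  a ∈ U → b ∈ U → a ≠ b → dg G U a = 1 → dg G U b = 1 →
  (∀ v ∈ U, v ≠ a → v ≠ b → dg G U v = 2 ∨ dg G U v = 3) →
  (∀ K, IsClosedIn G U K → K.Nonempty → a ∉ K → b ∉ K → Mixed G U K) →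
  (∀ K, IsClosedIn G U K → a ∈ K → b ∈ K → ∃ u ∈ K, dg G U u = 3) →
  ∀ x : V → ℝ, LinearIndepOn ℚ x (Presc G U {a, b}) →
  ∀ z : ℝ, z ∉ Submodule.span ℚ (x '' Presc G U {a, b}) →
  SplitFits G U a b (Presc G U {a, b}) x z

/-! ### Constructing split drawings -/

theorem exists_cycleDrawn {U K : Finset V} {v : V} (hK : IsClosedIn G U K) (hv : v ∈ K)
    (hdg : ∀ u ∈ K, dg G U u = 2) :
    ∃ C ⊆ K, IsClosedIn G U C ∧ v ∈ C ∧ ∀ x : V → ℝ, Set.InjOn x (C.erase v) →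
      ∃ (X Y : V → ℝ) (σ : ℝ), CycleDrawn G C v x X Y σ := by
  obtain ⟨C, h1, h2, h3, h4⟩ := exists_cycle_drawn hK hv hdg
  refine ⟨C, h1, h2, h3, fun x hx => ?_⟩
  obtain ⟨X, Y, σ, h⟩ := h4 x hx
  exact ⟨X, Y, σ, ⟨h.1, h.2.1, h.2.2.1, h.2.2.2.1, h.2.2.2.2.1, h.2.2.2.2.2⟩⟩

/-- The cycle through `b` is a whole component, so it can serve as the upper part and be lifted
freely, above a drawing of the rest with `a` highest. Its vertex `b` has an abscissa in the span of
prescribed ones, hence different from `z`. -/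
theorem splitFits_of_cycle {U K : Finset V} {a b : V}
    (ih : ∀ W : Finset V, W.card < U.card → TopDrawable G W a)
    (ha : a ∈ U) (hda : dg G U a = 1 ∨ dg G U a = 2)
    (hdg : ∀ v ∈ U, v ≠ a → v ≠ b → dg G U v = 2 ∨ dg G U v = 3)
    (hgood : ∀ K, IsClosedIn G U K → K.Nonempty → a ∉ K → b ∉ K → Mixed G U K)
    (hK : IsClosedIn G U K) (hbK : b ∈ K) (haK : a ∉ K) (hK2 : ∀ u ∈ K, dg G U u = 2)
    {x : V → ℝ} (hx : LinearIndepOn ℚ x (Presc G U {a, b})) {z : ℝ}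
    (hz : z ∉ Submodule.span ℚ (x '' Presc G U {a, b})) :
    SplitFits G U a b (Presc G U {a, b}) x z := by
  obtain ⟨C, hCK, hC, hbC, hcyc⟩ := exists_cycleDrawn hK hbK hK2
  have haC : a ∉ C := fun h => haK (hCK h)
  have hC2 : ∀ u ∈ C, dg G U u = 2 := fun u hu => hK2 u (hCK hu)
  have hsub : ∀ v ∈ U \ C, v ∈ U ∧ v ∉ C := fun v hv => Finset.mem_sdiff.1 hv
  have hd : ∀ v ∈ U \ C, dg G (U \ C) v = dg G U v := fun v hv =>
    dg_sdiff hC (hsub v hv).1 (hsub v hv).2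
  have hbP : b ∉ Presc G U {a, b} := by
    rintro ⟨-, h | h⟩
    · rw [hC2 b hbC] at h; omega
    · simp at h
  have hCP : ∀ u ∈ C, u ≠ b → u ∈ Presc G U {a, b} := fun u hu hub =>
    ⟨hC.1 hu, Or.inr ⟨hC2 u hu, by
      simp only [Finset.mem_insert, Finset.mem_singleton, not_or]
      exact ⟨by rintro rfl; exact haC hu, hub⟩⟩⟩
  have hPP : Presc G (U \ C) {a} = Presc G U {a, b} \ C := by
    ext v
    constructor
    · rintro ⟨h1, h2⟩
      rw [hd v h1] at h2
      refine ⟨⟨(hsub v h1).1, h2.imp_right fun h => ⟨h.1, ?_⟩⟩, (hsub v h1).2⟩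
      have hvb : v ≠ b := by rintro rfl; exact (hsub v h1).2 hbC
      simpa [hvb] using h.2
    · rintro ⟨⟨h1, h2⟩, h3⟩
      have h1' : v ∈ U \ C := Finset.mem_sdiff.2 ⟨h1, h3⟩
      refine ⟨h1', ?_⟩
      rw [hd v h1']
      exact h2.imp_right fun h => ⟨h.1, fun h' => h.2 (by simp at h'; simp [h'])⟩
  have hcard : (U \ C).card < U.card :=
    Finset.card_lt_card (Finset.sdiff_ssubset hC.1 ⟨b, hbC⟩)
  have ha' : a ∈ U \ C := Finset.mem_sdiff.2 ⟨ha, haC⟩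
  obtain ⟨X₁, Y₁, hF, htop, -⟩ := ih (U \ C) hcard ha' (by rwa [hd a ha'])
    (fun v hv hva => by
      rw [hd v hv]
      exact hdg v (hsub v hv).1 hva (by rintro rfl; exact (hsub v hv).2 hbC))
    (fun K' hK' hne haK' => by
      refine (hgood K' (hC.of_sdiff hK') hne haK' fun hb => ?_).congr fun v hv => hd v (hK'.1 hv)
      exact (hsub b (hK'.1 hb)).2 hbC)
    x (hx.mono (by rw [hPP]; exact Set.sdiff_subset)) z
    (fun h => hz (Submodule.span_mono (Set.image_mono (by rw [hPP]; exact Set.sdiff_subset)) h))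
  rw [hPP] at hF
  obtain ⟨X₂, Y₂, σ, h₂⟩ := hcyc x (hx.injOn.mono fun u hu => by
    have hu := Finset.mem_erase.1 (Finset.mem_coe.1 hu)
    exact hCP u hu.2 hu.1)
  obtain ⟨X, Y, h1, h3, h4, h5, h6⟩ :=
    Fits.cycle_above hC hx presc_subset hbP hCP hF h₂
  refine ⟨C, X, Y, σ, hC.1, h₂.sign, ha', hbC, h6, ?_, ?_, ?_, h5, ?_⟩
  · intro u hu
    rw [(h1 u hu).2, (h1 a ha').2]; exact htop u hu
  · intro u hu
    have := h4 u hu b hbC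
    have := h₂.top u hu
    linarith
  · intro u hu hub _
    rw [h3 u hu, h3 b hbC]; exact h₂.side u hu hub
  · rw [h3 b hbC]
    rintro rfl
    refine hz (Submodule.span_mono (Set.image_mono fun u hu => ?_) h₂.span)
    have hu := Finset.mem_erase.1 (Finset.mem_coe.1 hu)
    exact hCP u hu.2 hu.1

/-- A new highest vertex is added to the upper part. -/
theorem SplitFits.insert_high {U : Finset V} {a b c : V} {P Q : Set V} {x : V → ℝ} {z : ℝ}
    (h : SplitFits G U a c P x (x b)) (hPU : P ⊆ U) (hb : b ∉ U)
    (hnb : ∀ u ∈ U, G.Adj b u → u = c) (hP : ∀ d ∈ P, x d ≠ x b) (hQ : Q ⊆ insert b P)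
    (hz : x b ≠ z) : SplitFits G (insert b U) a b Q x z := by
  obtain ⟨H, X, Y, σ, hHU, hσ, ha, hc, hfit, hta, htc, hside, hlt, hXc⟩ := h
  have haU := (Finset.mem_sdiff.1 ha).1
  have haH := (Finset.mem_sdiff.1 ha).2
  have hcU := hHU hc
  have hne : ∀ u ∈ U, u ≠ b := by rintro u hu rfl; exact hb hu
  have hbH : b ∉ H := fun h => hb (hHU h)
  have hpos : 0 < |x b - X c| := abs_pos.2 (sub_ne_zero.2 hXc.symm)
  set X' := Function.update X b (x b) with hX'
  set Y' := Function.update Y b (Y c + |x b - X c|) with hY'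
  have hXu : ∀ u ∈ U, X' u = X u := fun u hu => Function.update_of_ne (hne u hu) _ _
  have hYu : ∀ u ∈ U, Y' u = Y u := fun u hu => Function.update_of_ne (hne u hu) _ _
  have hXb : X' b = x b := Function.update_self _ _ _
  have hYb : Y' b = Y c + |x b - X c| := Function.update_self _ _ _
  have hsd : ∀ u ∈ insert b U \ insert b H, u ∈ U \ H := by
    intro u hu
    simp only [Finset.mem_sdiff, Finset.mem_insert, not_or] at hu ⊢
    exact ⟨hu.1.resolve_left hu.2.1, hu.2.2⟩
  refine ⟨insert b H, X', Y', σ, Finset.insert_subset_insert _ hHU, hσ, ?_,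
    Finset.mem_insert_self _ _, ?_, ?_, ?_, ?_, ?_, ?_⟩
  · simp [haU, haH, hne a haU]
  · intro M hM
    have hF := hfit M hM
    obtain ⟨X'', Y'', h1, h2, h3, h4, h5, h6, h7, h8⟩ := hF.insert_top hPU (ξ := x b) hcU
      (fun u hu => by
        simp only [if_pos hc]
        split_ifs with huH
        · linarith [htc u huH]
        · linarith [hlt u (Finset.mem_sdiff.2 ⟨hu, huH⟩) c hc]) hb hXc.symm
      (fun u hu hub => Or.inl (hnb u hu hub))
    have hXX : ∀ u ∈ insert b U, X' u = X'' u := by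
      intro u hu
      rcases Finset.mem_insert.1 hu with rfl | hu'
      · rw [hXb, h3]
      · rw [hXu u hu', h1 u hu']
    have hYY : ∀ u ∈ insert b U,
        (fun v => if v ∈ insert b H then Y' v + M else Y' v) u = Y'' u := by
      intro u hu
      rcases Finset.mem_insert.1 hu with rfl | hu'
      · simp only [Finset.mem_insert_self, if_true, hYb, h4, if_pos hc]; ring
      · rw [h2 u hu']
        simp only [Finset.mem_insert, hne u hu', false_or, hYu u hu']
    have hbU : b ∈ insert b U := Finset.mem_insert_self _ _
    refine ⟨h5.congr hXX hYY, ?_, ?_⟩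
    · intro d hd
      rcases hQ hd with rfl | hd'
      · exact hXb
      · rw [hXu d (hPU hd')]; exact hF.eq d hd'
    · intro d hd
      rcases hQ hd with rfl | hd'
      · exact h7.congr hbU hXX hYY
      · exact (h8 d hd' (hP d hd')).congr (Finset.mem_insert_of_mem (hPU hd')) hXX hYY
  · intro u hu
    have hu' := hsd u hu
    rw [hYu u (Finset.mem_sdiff.1 hu').1, hYu a haU]; exact hta u hu'
  · intro u hu
    rcases Finset.mem_insert.1 hu with rfl | hu'
    · exact le_rfl
    · rw [hYu u (hHU hu'), hYb]; linarith [htc u hu']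
  -- The side condition becomes void: `b` is now strictly higher than the old upper part.
  · intro u hu hub he
    have hu' := (Finset.mem_insert.1 hu).resolve_left hub
    rw [hYu u (hHU hu'), hYb] at he
    linarith [htc u hu']
  · intro u hu v hv
    have hu' := hsd u hu
    rw [hYu u (Finset.mem_sdiff.1 hu').1]
    rcases Finset.mem_insert.1 hv with rfl | hv'
    · rw [hYb]; linarith [hlt u hu' c hc]
    · rw [hYu v (hHU hv')]; exact hlt u hu' v hv'
  · rw [hXb]; exact hz

/-- The upper part can be a single vertex, drawn above its neighbours. -/
theorem splitFits_singleton {U : Finset V} {a b : V} {P Q : Set V} {x x' X Y : V → ℝ} {z : ℝ}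
    (h : Fits G U P x' X Y) (hPU : P ⊆ U) (ha : a ∈ U) (htop : ∀ u ∈ U, Y u ≤ Y a) (hb : b ∉ U)
    (hnb : ∀ u ∈ U, G.Adj b u → u ∈ P ∧ x' u = x b)
    (hQ : ∀ d ∈ Q, d = b ∨ (d ∈ P ∧ x' d = x d ∧ x d ≠ x b))
    (hz : x b ≠ z) : SplitFits G (insert b U) a b Q x z := by
  have hne : ∀ u ∈ U, u ≠ b := by rintro u hu rfl; exact hb hu
  have hbU : b ∈ insert b U := Finset.mem_insert_self _ _
  set X' := Function.update X b (x b) with hX'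
  -- Any height above `a` would do, since all edges at `b` are vertical.
  set Y' := Function.update Y b (Y a + 1) with hY'
  have hXu : ∀ u ∈ U, X' u = X u := fun u hu => Function.update_of_ne (hne u hu) _ _
  have hYu : ∀ u ∈ U, Y' u = Y u := fun u hu => Function.update_of_ne (hne u hu) _ _
  have hXb : X' b = x b := Function.update_self _ _ _
  have hYb : Y' b = Y a + 1 := Function.update_self _ _ _
  have hsd : ∀ u ∈ insert b U \ {b}, u ∈ U := by
    intro u hu
    simp only [Finset.mem_sdiff, Finset.mem_insert, Finset.mem_singleton] at hu
    exact hu.1.resolve_left hu.2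
  refine ⟨{b}, X', Y', 1, by simp, Or.inl rfl, by simp [ha, hne a ha], by simp, ?_, ?_, ?_, ?_,
    ?_, by rw [hXb]; exact hz⟩
  · intro M hM
    set Y'' := fun v => if v ∈ ({b} : Finset V) then Y' v + M else Y' v with hY''
    have hYu' : ∀ u ∈ U, Y'' u = Y u := fun u hu => by
      simp [hY'', hne u hu, hYu u hu]
    have hYb' : Y'' b = Y a + 1 + M := by simp [hY'', hYb]
    have hlt : ∀ u ∈ U, Y'' u < Y'' b := fun u hu => by
      rw [hYu' u hu, hYb']; linarith [htop u hu]
    have hF := h.congr hPU hXu hYu'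
    refine ⟨?_, ?_, ?_⟩
    · rw [Finset.insert_eq, Finset.union_comm]
      refine hF.drawn.stack (Drawn.singleton b X' Y'') ?_ ?_
      · intro u hu v hv; rw [Finset.mem_singleton.1 hv]; exact hlt u hu
      · intro u hu v hv huv
        obtain rfl := Finset.mem_singleton.1 hv
        obtain ⟨h1, h2⟩ := hnb u hu huv.symm
        left
        refine ⟨by rw [hF.eq u h1, h2, hXb], hF.free u h1, ?_⟩
        intro w hw hwv; exact absurd (Finset.mem_singleton.1 hw) hwv
    · intro d hd
      rcases hQ d hd with rfl | ⟨h1, h2, -⟩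
      · exact hXb
      · rw [hF.eq d h1, h2]
    · intro d hd u hu hud he
      rcases hQ d hd with rfl | ⟨h1, h2, h3⟩
      · exact hlt u ((Finset.mem_insert.1 hu).resolve_left hud)
      · rcases Finset.mem_insert.1 hu with rfl | hu'
        · rw [hXb, hF.eq d h1, h2] at he
          exact absurd he.symm h3
        · exact hF.free d h1 u hu' hud he
  · intro u hu
    rw [hYu u (hsd u hu), hYu a ha]; exact htop u (hsd u hu)
  · intro u hu; rw [Finset.mem_singleton.1 hu]
  · intro u hu hub; exact absurd (Finset.mem_singleton.1 hu) hub
  · intro u hu v hv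
    rw [Finset.mem_singleton.1 hv, hYb, hYu u (hsd u hu)]
    linarith [htop u (hsd u hu)]

theorem mem_span_of_mem {Q : Set V} {x : V → ℝ} {b : V} (hb : b ∈ Q) :
    x b ∈ Submodule.span ℚ (x '' Q) := Submodule.subset_span ⟨b, hb, rfl⟩

/-- When `b` is removed, its abscissa is handed to the neighbour `c`, so that `b` can later be put
back straight above `c`. -/
theorem linearIndepOn_update_of_subset {P Q : Set V} {x : V → ℝ} (hx : LinearIndepOn ℚ x Q)
    {b c : V} (hb : b ∈ Q) (hc : c ∉ Q) (hP : P ⊆ insert c (Q \ {b})) :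
    LinearIndepOn ℚ (Function.update x c (x b)) P :=
  (linearIndepOn_update (hx.mono Set.sdiff_subset) (fun h => hc h.1)
    (hx.notMem_span hb)).mono hP

/-- Removing a vertex of degree one from a split drawing. -/
theorem splitDrawable_of_forall_lt {U : Finset V}
    (ihT : ∀ W : Finset V, W.card < U.card → ∀ a, TopDrawable G W a)
    (ihS : ∀ W : Finset V, W.card < U.card → ∀ a b, SplitDrawable G W a b) (a b : V) :
    SplitDrawable G U a b := by
  intro ha hb hab hda hdb hdg hgood hthree x hx z hz
  obtain ⟨c, hcU, hbc, hbn⟩ := exists_nbr_of_dg_eq_one hdb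
  -- Otherwise `{a, b}` is a closed set without a vertex of degree three, against `hthree`.
  have hca : c ≠ a := by
    rintro rfl
    obtain ⟨e, heU, hce, hcn⟩ := exists_nbr_of_dg_eq_one hda
    have heb : b = e := hcn b hb hbc.symm
    subst heb
    obtain ⟨u, hu, h3⟩ := hthree {c, b} ⟨by
        intro u hu
        rcases Finset.mem_insert.1 hu with rfl | hu
        · exact ha
        · rwa [Finset.mem_singleton.1 hu], by
        intro u hu v hv huv
        rcases Finset.mem_insert.1 hu with rfl | hu
        · rw [hcn v hv huv]; simp
        · rw [Finset.mem_singleton.1 hu] at huv; rw [hbn v hv huv]; simp⟩ (by simp) (by simp)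
    rcases Finset.mem_insert.1 hu with rfl | hu
    · omega
    · rw [Finset.mem_singleton.1 hu] at h3; omega
  have hcb : c ≠ b := hbc.ne'
  have hab' : ¬ G.Adj a b := fun h => hca (hbn a ha h.symm).symm
  have hdg' : ∀ v ∈ U, v ≠ c → dg G (U.erase b) v = dg G U v := fun v hv hvc =>
    dg_erase_of_not_adj fun h => hvc (hbn v hv h.symm)
  have hdc := dg_erase_of_adj hb hbc.symm
  have hda' : dg G (U.erase b) a = 1 := by rw [hdg' a ha hca.symm, hda]
  have hcard : (U.erase b).card < U.card := Finset.card_erase_lt_of_mem hb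
  have hUb : insert b (U.erase b) = U := Finset.insert_erase hb
  have hbU : b ∉ U.erase b := Finset.notMem_erase _ _
  have haU : a ∈ U.erase b := Finset.mem_erase.2 ⟨hab, ha⟩
  have hcU' : c ∈ U.erase b := Finset.mem_erase.2 ⟨hcb, hcU⟩
  have hnb : ∀ u ∈ U.erase b, G.Adj b u → u = c := fun u hu => hbn u (Finset.mem_of_mem_erase hu)
  have hmem : ∀ v ∈ U.erase b, v ≠ b ∧ v ∈ U := fun v hv => Finset.mem_erase.1 hv
  have hbP : b ∈ Presc G U {a, b} := ⟨hb, Or.inl hdb⟩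
  have hxz : x b ≠ z := fun h => hz (h ▸ mem_span_of_mem hbP)
  have hinj := hx.injOn
  have hdd : ∀ v ∈ U.erase b, v ≠ a → v ≠ c → dg G (U.erase b) v = 2 ∨ dg G (U.erase b) v = 3 := by
    intro v hv hva hvc
    rw [hdg' v (hmem v hv).2 hvc]
    exact hdg v (hmem v hv).2 hva (hmem v hv).1
  have hgood' : ∀ K, IsClosedIn G (U.erase b) K → K.Nonempty → a ∉ K → c ∉ K →
      Mixed G (U.erase b) K := by
    intro K hK hne haK hcK
    refine (hgood K (hK.of_erase fun u hu hub => ?_) hne haK fun h => hbU (hK.1 h)).congr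
      fun v hv => hdg' v (hmem v (hK.1 hv)).2 (by rintro rfl; exact hcK hv)
    rw [hnb u (hK.1 hu) hub.symm] at hu
    exact hcK hu
  have hPP : Presc G (U.erase b) {a, c} = Presc G U {a, b} \ {b} := by
    ext v
    simp only [Presc, Set.mem_ofPred_eq, Set.mem_sdiff, Set.mem_singleton_iff, Finset.mem_erase,
      Finset.mem_insert, Finset.mem_singleton, not_or]
    by_cases hvc : v = c
    · subst hvc
      have := hdg v hcU hca hcb
      constructor
      · rintro ⟨h1, h2⟩
        have h2 := h2.resolve_right fun h => h.2.2 rfl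
        exact ⟨⟨h1.2, Or.inr ⟨by omega, hca, hcb⟩⟩, hcb⟩
      · rintro ⟨⟨h1, h2⟩, -⟩
        exact ⟨⟨hcb, h1⟩, Or.inl (by omega)⟩
    · constructor
      · rintro ⟨h1, h2⟩
        rw [hdg' v h1.2 hvc] at h2
        exact ⟨⟨h1.2, h2.imp_right fun h => ⟨h.1, h.2.1, h1.1⟩⟩, h1.1⟩
      · rintro ⟨⟨h1, h2⟩, h3⟩
        rw [hdg' v h1 hvc]
        exact ⟨⟨h3, h1⟩, h2.imp_right fun h => ⟨h.1, h.2.1, hvc⟩⟩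
  have hx' : LinearIndepOn ℚ x (Presc G (U.erase b) {a, c}) := by
    rw [hPP]; exact hx.mono Set.sdiff_subset
  have hz' : x b ∉ Submodule.span ℚ (x '' Presc G (U.erase b) {a, c}) := by
    rw [hPP]; exact hx.notMem_span hbP
  have fin : SplitFits G (U.erase b) a c (Presc G (U.erase b) {a, c}) x (x b) →
      SplitFits G U a b (Presc G U {a, b}) x z := by
    intro h
    rw [← hUb]
    refine h.insert_high presc_subset hbU hnb ?_ ?_ hxz
    · intro d hd he
      rw [hPP] at hd
      exact hd.2 (hinj hd.1 hbP he)
    · rw [hPP, hUb]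
      intro v hv
      by_cases h : v = b
      · exact Or.inl h
      · exact Or.inr ⟨hv, h⟩
  -- If `c` has degree two, it replaces `b` as a vertex of degree one. If it has degree three and is
  -- left on a cycle avoiding `a`, that cycle is the upper part, with `b` added on top. Otherwise
  -- `b` alone is the upper part, straight above `c`.
  rcases hdg c hcU hca hcb with hc2 | hc3
  · refine fin (ihS _ hcard a c haU hcU' hca.symm hda' (by omega) hdd hgood' ?_ x hx' _ hz')
    intro K hK haK hcK
    obtain ⟨u, hu, h3⟩ := hthree (insert b K)
      ⟨Finset.insert_subset hb (hK.1.trans (Finset.erase_subset _ _)), by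
        intro u hu v hv huv
        rcases Finset.mem_insert.1 hu with rfl | hu
        · rw [hbn v hv huv]; exact Finset.mem_insert_of_mem hcK
        · by_cases hvb : v = b
          · rw [hvb]; exact Finset.mem_insert_self _ _
          · exact Finset.mem_insert_of_mem (hK.2 u hu v (Finset.mem_erase.2 ⟨hvb, hv⟩) huv)⟩
      (Finset.mem_insert_of_mem haK) (Finset.mem_insert_self _ _)
    rcases Finset.mem_insert.1 hu with rfl | hu
    · omega
    · exact ⟨u, hu, by rw [hdg' u (hmem u (hK.1 hu)).2 (by rintro rfl; omega), h3]⟩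
  · by_cases hcyc : ∃ K, IsClosedIn G (U.erase b) K ∧ c ∈ K ∧ a ∉ K ∧
        ∀ u ∈ K, dg G (U.erase b) u = 2
    · obtain ⟨K, hK, hcK, haK, hK2⟩ := hcyc
      exact fin (splitFits_of_cycle (fun W hW => ihT W (hW.trans hcard) a) haU (Or.inl hda') hdd
        hgood' hK hcK haK hK2 hx' hz')
    · have hcP : c ∉ Presc G U {a, b} := by
        rintro ⟨-, h | h⟩ <;> omega
      have hsub : Presc G (U.erase b) {a} ⊆ insert c (Presc G U {a, b} \ {b}) := by
        rintro v ⟨h1, h2⟩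
        by_cases hvc : v = c
        · exact Or.inl hvc
        · rw [← hPP]
          exact Or.inr ⟨h1, h2.imp_right fun h => ⟨h.1, by simpa [hvc] using h.2⟩⟩
      obtain ⟨z', hz', -⟩ := exists_notMem_span (presc_finite (G := G) (U.erase b) {a})
        (Function.update x c (x b)) 0
      obtain ⟨X, Y, hF, htop, -⟩ := ihT _ hcard a haU (Or.inl hda')
        (fun v hv hva => by
          by_cases hvc : v = c
          · subst hvc; left; omega
          · exact hdd v hv hva hvc)
        (fun K hK hne haK => by
          by_cases hcK : c ∈ K
          · refine ⟨⟨c, hcK, by omega⟩, ?_⟩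
            by_contra hno
            refine hcyc ⟨K, hK, hcK, haK, fun u hu => ?_⟩
            by_cases huc : u = c
            · subst huc; omega
            · exact (hdd u (hK.1 hu) (by rintro rfl; exact haK hu) huc).resolve_right
                fun h => hno ⟨u, hu, h⟩
          · exact hgood' K hK hne haK hcK)
        (Function.update x c (x b)) (linearIndepOn_update_of_subset hx hbP hcP hsub) z' hz'
      have key : SplitFits G (insert b (U.erase b)) a b (Presc G U {a, b}) x z := by
        refine splitFits_singleton hF presc_subset haU htop hbU ?_ ?_ hxz
        · intro u hu hbu
          obtain rfl := hnb u hu hbu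
          exact ⟨⟨hu, Or.inr ⟨by omega, by simpa using hca⟩⟩, Function.update_self _ _ _⟩
        · intro d hd
          by_cases hdb : d = b
          · exact Or.inl hdb
          · have hdc : d ≠ c := by rintro rfl; exact hcP hd
            refine Or.inr ⟨?_, Function.update_of_ne hdc _ _, fun h => hdb (hinj hd hbP h)⟩
            have hd' : d ∈ Presc G (U.erase b) {a, c} := by rw [hPP]; exact ⟨hd, hdb⟩
            exact ⟨hd'.1, hd'.2.imp_right fun h => ⟨h.1, fun h' => h.2 (by simp at h'; simp [h'])⟩⟩
      rwa [hUb] at key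

/-- `Fits.insert_top` with the prescribed abscissas changed. -/
theorem Fits.insert_over {S : Finset V} {P Q : Set V} {x x' X Y : V → ℝ} (h : Fits G S P x' X Y)
    (hPS : P ⊆ S) {a v : V} {ξ : ℝ} (ha : a ∈ S) (htop : ∀ u ∈ S, Y u ≤ Y a) (hv : v ∉ S)
    (hξ : ξ ≠ X a) (hnb : ∀ u ∈ S, G.Adj v u → u = a ∨ (u ∈ P ∧ x' u = ξ))
    (hQ : ∀ d ∈ Q, (d = v ∧ x d = ξ) ∨ (d ∈ P ∧ x' d = x d ∧ x d ≠ ξ)) :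
    ∃ X' Y' : V → ℝ, Fits G (insert v S) Q x X' Y' ∧ (∀ u ∈ insert v S, Y' u ≤ Y' v) ∧
      X' v = ξ ∧ NorthFree (insert v S) X' Y' v := by
  obtain ⟨X', Y', h1, h2, h3, -, h5, h6, h7, h8⟩ := h.insert_top hPS ha htop hv hξ hnb
  refine ⟨X', Y', ⟨h5, fun d hd => ?_, fun d hd => ?_⟩, fun u hu => ?_, h3, h7⟩
  · rcases hQ d hd with ⟨rfl, h⟩ | ⟨hP, he, -⟩
    · rw [h3, h]
    · rw [h1 d (hPS hP), h.eq d hP, he]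
  · rcases hQ d hd with ⟨rfl, -⟩ | ⟨hP, he, hne⟩
    · exact h7
    · exact h8 d hP (by rwa [he])
  · rcases Finset.mem_insert.1 hu with rfl | hu
    · exact le_rfl
    · exact (h6 u hu).le

/-- `d` is a vertex of degree two of `G[U]` with the neighbours `a` and `b`, where the degrees of
`G[U]` are two and three and both occur in every component that avoids `d`. -/
structure Branch (G : SimpleGraph V) (U : Finset V) (d a b : V) : Prop where
  mem : d ∈ U
  left_mem : a ∈ U
  right_mem : b ∈ U
  ne : a ≠ b
  left_adj : G.Adj d a
  right_adj : G.Adj d b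
  nbr : ∀ u ∈ U, G.Adj d u → u = a ∨ u = b
  dg_eq : dg G U d = 2
  dg_mem : ∀ v ∈ U, dg G U v = 2 ∨ dg G U v = 3
  mixed : ∀ K, IsClosedIn G U K → K.Nonempty → d ∉ K → Mixed G U K

/-! ### Removing a vertex of degree two -/

namespace Branch

variable {U : Finset V} {d a b : V}

theorem symm (h : Branch G U d a b) : Branch G U d b a :=
  ⟨h.mem, h.right_mem, h.left_mem, h.ne.symm, h.right_adj, h.left_adj,
    fun u hu hdu => (h.nbr u hu hdu).symm, h.dg_eq, h.dg_mem, h.mixed⟩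

theorem insert_erase (h : Branch G U d a b) : insert d (U.erase d) = U :=
  Finset.insert_erase h.mem

theorem card_lt (h : Branch G U d a b) : (U.erase d).card < U.card :=
  Finset.card_erase_lt_of_mem h.mem

theorem left_mem_erase (h : Branch G U d a b) : a ∈ U.erase d :=
  Finset.mem_erase.2 ⟨h.left_adj.ne', h.left_mem⟩

theorem dg_left (h : Branch G U d a b) : dg G (U.erase d) a + 1 = dg G U a :=
  dg_erase_of_adj h.mem h.left_adj.symm

theorem dg_left_mem (h : Branch G U d a b) :
    dg G (U.erase d) a = 1 ∨ dg G (U.erase d) a = 2 := by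
  have := h.dg_left
  have := h.dg_mem a h.left_mem
  omega

theorem dg_other (h : Branch G U d a b) {v : V} (hv : v ∈ U) (hva : v ≠ a) (hvb : v ≠ b) :
    dg G (U.erase d) v = dg G U v :=
  dg_erase_of_not_adj fun hvd => (h.nbr v hv hvd.symm).elim hva hvb

theorem dg_other_mem (h : Branch G U d a b) :
    ∀ v ∈ U.erase d, v ≠ a → v ≠ b → dg G (U.erase d) v = 2 ∨ dg G (U.erase d) v = 3 := by
  intro v hv hva hvb
  have hv := Finset.mem_of_mem_erase hv
  rw [h.dg_other hv hva hvb]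
  exact h.dg_mem v hv

theorem mixed_other (h : Branch G U d a b) :
    ∀ K, IsClosedIn G (U.erase d) K → K.Nonempty → a ∉ K → b ∉ K → Mixed G (U.erase d) K := by
  intro K hK hne haK hbK
  have hKU := hK.1.trans (Finset.erase_subset _ _)
  refine (h.mixed K (hK.of_erase fun u hu hud => ?_) hne fun hd => ?_).congr fun v hv =>
    h.dg_other (hKU hv) (by rintro rfl; exact haK hv) (by rintro rfl; exact hbK hv)
  · rcases h.nbr u (hKU hu) hud.symm with rfl | rfl
    · exact haK hu
    · exact hbK hu
  · exact Finset.notMem_erase _ _ (hK.1 hd)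

/-- A neighbour of `d` of degree two drops to degree one and stays prescribed; one of degree three
drops to two, where the exception `{a, b}` keeps it unprescribed. -/
theorem presc_erase (h : Branch G U d a b) : Presc G (U.erase d) {a, b} = Presc G U {d} := by
  ext v
  simp only [Presc, Set.mem_ofPred_eq, Finset.mem_erase, Finset.mem_insert, Finset.mem_singleton,
    not_or]
  by_cases hvd : v = d
  · subst hvd
    simp [h.dg_eq]
  by_cases hv : v ∈ U
  swap
  · simp [hv]
  by_cases hva : v = a
  · subst hva
    have := h.dg_left
    have := h.dg_mem v h.left_mem
    simp [hvd, h.left_mem]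
    omega
  by_cases hvb : v = b
  · subst hvb
    have := h.symm.dg_left
    have := h.dg_mem v h.right_mem
    simp [hvd, h.right_mem]
    omega
  simp [hvd, hva, hvb, hv, h.dg_other hv hva hvb]

theorem notMem_presc (h : Branch G U d a b) : d ∉ Presc G U {d} := by
  rintro ⟨-, h' | h'⟩
  · have := h.dg_eq; omega
  · simp at h'

theorem presc_empty (h : Branch G U d a b) : Presc G U ∅ = insert d (Presc G U {d}) := by
  ext v
  simp only [Presc, Set.mem_ofPred_eq, Finset.mem_singleton, Set.mem_insert_iff,
    Finset.notMem_empty]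
  by_cases hvd : v = d
  · subst hvd
    simp [h.dg_eq, h.mem]
  · simp [hvd]

/-- If `b` does not lie on a cycle that is a component of `G[U] - d` and avoids `a`, then `d` can
be the highest vertex, straight above `b`. -/
theorem exists_fits_above (h : Branch G U d a b) (ihT : TopDrawable G (U.erase d) a)
    (hb : dg G U b = 3)
    (hcyc : ¬ ∃ K, IsClosedIn G (U.erase d) K ∧ b ∈ K ∧ a ∉ K ∧ ∀ u ∈ K, dg G (U.erase d) u = 2)
    {x : V → ℝ} (hx : LinearIndepOn ℚ x (Presc G U {d})) {ξ : ℝ}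
    (hξ : ξ ∉ Submodule.span ℚ (x '' Presc G U {d})) :
    ∃ X Y, Fits G U (Presc G U {d}) x X Y ∧ (∀ u ∈ U, Y u ≤ Y d) ∧ X d = ξ ∧
      NorthFree U X Y d := by
  have hdb : dg G (U.erase d) b = 2 := by have := h.symm.dg_left; omega
  have hbP : b ∉ Presc G U {d} := by rintro ⟨-, h | h⟩ <;> omega
  have hbP' : b ∈ Presc G (U.erase d) {a} :=
    ⟨h.symm.left_mem_erase, Or.inr ⟨hdb, by simpa using h.ne.symm⟩⟩
  have hsub : Presc G (U.erase d) {a} ⊆ insert b (Presc G U {d}) := by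
    rintro v ⟨h1, h2⟩
    by_cases hvb : v = b
    · exact Or.inl hvb
    · rw [← h.presc_erase]
      exact Or.inr ⟨h1, h2.imp_right fun h => ⟨h.1, by simpa [hvb] using h.2⟩⟩
  obtain ⟨z, hz, -⟩ := exists_notMem_span (presc_finite (G := G) (U.erase d) {a})
    (Function.update x b ξ) 0
  obtain ⟨X, Y, hF, htop, -⟩ := ihT h.left_mem_erase h.dg_left_mem
    (fun v hv hva => by
      by_cases hvb : v = b
      · subst hvb; exact Or.inl hdb
      · exact h.dg_other_mem v hv hva hvb)
    (fun K hK hne haK => by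
      by_cases hbK : b ∈ K
      · refine ⟨⟨b, hbK, hdb⟩, ?_⟩
        by_contra hno
        refine hcyc ⟨K, hK, hbK, haK, fun u hu => ?_⟩
        by_cases hub : u = b
        · subst hub; exact hdb
        · exact (h.dg_other_mem u (hK.1 hu) (by rintro rfl; exact haK hu) hub).resolve_right
            fun h => hno ⟨u, hu, h⟩
      · exact h.mixed_other K hK hne haK hbK)
    (Function.update x b ξ) ((linearIndepOn_update hx hbP hξ).mono hsub) z hz
  have hxb : Function.update x b ξ b = ξ := Function.update_self _ _ _
  -- If `a` lay on the vertical line through `b`, it would be strictly below `b`, although it is a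
  -- highest vertex.
  have hξa : ξ ≠ X a := by
    intro he
    have h1 := hF.free b hbP' a h.left_mem_erase h.ne (by rw [hF.eq b hbP', hxb, he])
    exact absurd (htop b h.symm.left_mem_erase) (not_le.2 h1)
  have key := hF.insert_over (x := x) (Q := Presc G U {d}) presc_subset h.left_mem_erase htop
    (Finset.notMem_erase d U) hξa
    (fun u hu hdu => (h.nbr u (Finset.mem_of_mem_erase hu) hdu).imp_right (by
      rintro rfl; exact ⟨hbP', hxb⟩))
    (fun e he => by
      have heb : e ≠ b := by rintro rfl; exact hbP he
      refine Or.inr ⟨?_, Function.update_of_ne heb _ _, fun h => hξ (h ▸ mem_span_of_mem he)⟩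
      rw [← h.presc_erase] at he
      exact ⟨he.1, he.2.imp_right fun h => ⟨h.1, fun h' => h.2 (by simp at h'; simp [h'])⟩⟩)
  rwa [h.insert_erase] at key

theorem exists_fits_of_splitFits (h : Branch G U d a b) {x : V → ℝ} {z' : ℝ}
    (hs : SplitFits G (U.erase d) a b (Presc G (U.erase d) {a, b}) x z') (z : ℝ) :
    ∃ X Y, Fits G U (Presc G U {d}) x X Y ∧ (∀ u ∈ U, Y u ≤ Y d) ∧ X d ≠ z := by
  have key := hs.insert_far (z := z) presc_subset (Finset.notMem_erase d U)
    (fun u hu => h.nbr u (Finset.mem_of_mem_erase hu))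
  rwa [h.insert_erase, h.presc_erase] at key

theorem exists_fits_of_cycle (h : Branch G U d a b)
    (ihT : ∀ W : Finset V, W.card < U.card → ∀ a, TopDrawable G W a)
    (hcyc : ∃ K, IsClosedIn G (U.erase d) K ∧ b ∈ K ∧ a ∉ K ∧ ∀ u ∈ K, dg G (U.erase d) u = 2)
    {x : V → ℝ} (hx : LinearIndepOn ℚ x (Presc G U {d})) (z : ℝ) :
    ∃ X Y, Fits G U (Presc G U {d}) x X Y ∧ (∀ u ∈ U, Y u ≤ Y d) ∧ X d ≠ z := by
  obtain ⟨K, hK, hbK, haK, hK2⟩ := hcyc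
  obtain ⟨z', hz', -⟩ := exists_notMem_span (presc_finite (G := G) U {d}) x 0
  rw [← h.presc_erase] at hx hz'
  exact h.exists_fits_of_splitFits (splitFits_of_cycle (fun W hW => ihT W (hW.trans h.card_lt) a)
    h.left_mem_erase h.dg_left_mem h.dg_other_mem h.mixed_other hK hbK haK hK2 hx hz') z

end Branch

/-- Without `a` its neighbour `c` can be made highest, with an abscissa other than `x a`; then `a`
is put above `c` along a genuine diagonal. -/
theorem topDrawable_of_dg_eq_one {U : Finset V} {a : V}
    (ihT : ∀ W : Finset V, W.card < U.card → ∀ a, TopDrawable G W a) (hda : dg G U a = 1) :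
    TopDrawable G U a := by
  intro ha _ hdg hgood x hx z hz
  obtain ⟨c, hcU, hac, han⟩ := exists_nbr_of_dg_eq_one hda
  have hca : c ≠ a := hac.ne'
  have hmem : ∀ v ∈ U.erase a, v ≠ a ∧ v ∈ U := fun v hv => Finset.mem_erase.1 hv
  have hdg' : ∀ v ∈ U, v ≠ c → dg G (U.erase a) v = dg G U v := fun v hv hvc =>
    dg_erase_of_not_adj fun h => hvc (han v hv h.symm)
  have hdc := dg_erase_of_adj ha hac.symm
  have hdc' := hdg c hcU hca
  have haP : a ∈ Presc G U {a} := ⟨ha, Or.inl hda⟩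
  have hcU' : c ∈ U.erase a := Finset.mem_erase.2 ⟨hca, hcU⟩
  have haU : a ∉ U.erase a := Finset.notMem_erase _ _
  have hPP : Presc G (U.erase a) {c} = Presc G U {a} \ {a} := by
    ext v
    simp only [Presc, Set.mem_ofPred_eq, Set.mem_sdiff, Set.mem_singleton_iff, Finset.mem_erase,
      Finset.mem_singleton]
    by_cases hva : v = a
    · simp [hva]
    by_cases hv : v ∈ U
    swap
    · simp [hv]
    by_cases hvc : v = c
    · subst hvc
      simp [hva, hv]
      omega
    · simp [hva, hv, hvc, hdg' v hv hvc]
  obtain ⟨X, Y, hF, htop, hXc⟩ := ihT _ (Finset.card_erase_lt_of_mem ha) c hcU' (by omega)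
    (fun v hv hvc => by
      rw [hdg' v (hmem v hv).2 hvc]; exact hdg v (hmem v hv).2 (hmem v hv).1)
    (fun K hK hne hcK => by
      refine (hgood K (hK.of_erase fun u hu hua => ?_) hne fun h => haU (hK.1 h)).congr
        fun v hv => hdg' v (hmem v (hK.1 hv)).2 (by rintro rfl; exact hcK hv)
      rw [han u (hmem u (hK.1 hu)).2 hua.symm] at hu
      exact hcK hu)
    x (by rw [hPP]; exact hx.mono Set.sdiff_subset) (x a) (by rw [hPP]; exact hx.notMem_span haP)
  obtain ⟨X', Y', h1, h2, h3, -⟩ := hF.insert_over (x := x) (Q := Presc G U {a}) presc_subset hcU'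
    htop haU hXc.symm (fun u hu hau => Or.inl (han u (hmem u hu).2 hau))
    (fun e he => by
      by_cases hea : e = a
      · exact Or.inl ⟨hea, by rw [hea]⟩
      · exact Or.inr ⟨by rw [hPP]; exact ⟨he, hea⟩, rfl, fun h => hea (hx.injOn he haP h)⟩)
  rw [Finset.insert_erase ha] at h1 h2
  exact ⟨X', Y', h1, h2, by rw [h3]; exact fun h => hz (h ▸ mem_span_of_mem haP)⟩

/-- Here `d` lies on a cycle component, whose one unprescribed abscissa is that of `d`. The cycle
goes above a drawing of the rest, and the abscissa of `d`, being in the span, avoids `z`. -/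
theorem topDrawable_of_cycle {U K : Finset V} {d : V}
    (ihD : ∀ W : Finset V, W.card < U.card → Drawable G W) (hK : IsClosedIn G U K) (hdK : d ∈ K)
    (hK2 : ∀ u ∈ K, dg G U u = 2) : TopDrawable G U d := by
  intro hd _ hdg hgood x hx z hz
  obtain ⟨C, hCK, hC, hdC, hcyc⟩ := exists_cycleDrawn hK hdK hK2
  have hC2 : ∀ u ∈ C, dg G U u = 2 := fun u hu => hK2 u (hCK hu)
  have hmem : ∀ v ∈ U \ C, v ∈ U ∧ v ∉ C := fun v hv => Finset.mem_sdiff.1 hv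
  have hne : ∀ v ∈ U \ C, v ≠ d := by rintro v hv rfl; exact (hmem v hv).2 hdC
  have hdg' : ∀ v ∈ U \ C, dg G (U \ C) v = dg G U v := fun v hv =>
    dg_sdiff hC (hmem v hv).1 (hmem v hv).2
  have hdP : d ∉ Presc G U {d} := by
    rintro ⟨-, h | h⟩
    · rw [hC2 d hdC] at h; omega
    · simp at h
  have hCP : ∀ u ∈ C, u ≠ d → u ∈ Presc G U {d} := fun u hu hud =>
    ⟨hC.1 hu, Or.inr ⟨hC2 u hu, by simpa using hud⟩⟩
  have hCP' : ((C.erase d : Finset V) : Set V) ⊆ Presc G U {d} := fun u hu => by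
    have hu := Finset.mem_erase.1 (Finset.mem_coe.1 hu)
    exact hCP u hu.2 hu.1
  have hPP : Presc G (U \ C) ∅ = Presc G U {d} \ C := by
    ext v
    by_cases hv : v ∈ U \ C
    · simp [Presc, hdg' v hv, hne v hv, (hmem v hv).2, (hmem v hv).1]
    · constructor
      · exact fun h => absurd h.1 hv
      · exact fun h => absurd (Finset.mem_sdiff.2 ⟨h.1.1, h.2⟩) hv
  obtain ⟨X₁, Y₁, h₁⟩ := ihD (U \ C)
    (Finset.card_lt_card (Finset.sdiff_ssubset hC.1 ⟨d, hdC⟩))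
    (fun v hv => by rw [hdg' v hv]; exact hdg v (hmem v hv).1 (hne v hv))
    (fun K hK hKne => (hgood K (hC.of_sdiff hK) hKne fun h => hne d (hK.1 h) rfl).congr
      fun v hv => hdg' v (hK.1 hv))
    x (by rw [hPP]; exact hx.mono Set.sdiff_subset)
  rw [hPP] at h₁
  obtain ⟨X₂, Y₂, σ, h₂⟩ := hcyc x (hx.injOn.mono hCP')
  obtain ⟨X, Y, -, h3, h4, h5, h6⟩ := Fits.cycle_above hC hx presc_subset hdP hCP h₁ h₂
  refine ⟨X, Y, by simpa using h6 0 le_rfl, fun u hu => ?_, ?_⟩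
  · by_cases huC : u ∈ C
    · have := h4 u huC d hdC
      have := h₂.top u huC
      linarith
    · exact (h5 u (Finset.mem_sdiff.2 ⟨hu, huC⟩) d hdC).le
  · rw [h3 d hdC]
    rintro rfl
    exact hz (Submodule.span_mono (Set.image_mono hCP') h₂.span)

/-- With the degree-one and cycle cases settled, `d` has two neighbours. If one is left on a cycle
avoiding the other, or if both have degree two, `d` is attached far to the side of a split drawing.
Otherwise one has degree three and `d` goes straight above it. -/
theorem topDrawable_of_forall_lt {U : Finset V}
    (ihD : ∀ W : Finset V, W.card < U.card → Drawable G W)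
    (ihT : ∀ W : Finset V, W.card < U.card → ∀ a, TopDrawable G W a)
    (ihS : ∀ W : Finset V, W.card < U.card → ∀ a b, SplitDrawable G W a b) (d : V) :
    TopDrawable G U d := by
  by_cases hd1 : dg G U d = 1
  · exact topDrawable_of_dg_eq_one ihT hd1
  by_cases hcyc : ∃ K, IsClosedIn G U K ∧ d ∈ K ∧ ∀ u ∈ K, dg G U u = 2
  · obtain ⟨K, hK, hdK, hK2⟩ := hcyc
    exact topDrawable_of_cycle ihD hK hdK hK2
  intro hd hd12 hdg hgood x hx z hz
  have hd2 := hd12.resolve_left hd1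
  obtain ⟨a, ha, b, hb, hab, hda, hdb, hnb⟩ := exists_nbrs_of_dg_eq_two hd2
  have h : Branch G U d a b := ⟨hd, ha, hb, hab, hda, hdb, hnb, hd2, fun v hv => by
    by_cases hvd : v = d
    · exact Or.inl (hvd ▸ hd2)
    · exact hdg v hv hvd, hgood⟩
  by_cases hcb : ∃ K, IsClosedIn G (U.erase d) K ∧ b ∈ K ∧ a ∉ K ∧ ∀ u ∈ K, dg G (U.erase d) u = 2
  · exact h.exists_fits_of_cycle ihT hcb hx z
  by_cases hca : ∃ K, IsClosedIn G (U.erase d) K ∧ a ∈ K ∧ b ∉ K ∧ ∀ u ∈ K, dg G (U.erase d) u = 2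
  · exact h.symm.exists_fits_of_cycle ihT hca hx z
  obtain ⟨ξ, hξ, hξz⟩ := exists_notMem_span (presc_finite (G := G) U {d}) x z
  rcases h.dg_mem b hb with hb2 | hb3
  swap
  · obtain ⟨X, Y, h1, h2, h3, -⟩ := h.exists_fits_above (ihT _ h.card_lt a) hb3 hcb hx hξ
    exact ⟨X, Y, h1, h2, by rwa [h3]⟩
  rcases h.dg_mem a ha with ha2 | ha3
  swap
  · obtain ⟨X, Y, h1, h2, h3, -⟩ := h.symm.exists_fits_above (ihT _ h.card_lt b) ha3 hca hx hξ
    exact ⟨X, Y, h1, h2, by rwa [h3]⟩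
  have hda' := h.dg_left
  have hdb' := h.symm.dg_left
  refine h.exists_fits_of_splitFits (z' := ξ) (ihS _ h.card_lt a b h.left_mem_erase
    h.symm.left_mem_erase hab (by omega) (by omega) h.dg_other_mem h.mixed_other ?_ x
    (by rwa [h.presc_erase]) ξ (by rwa [h.presc_erase])) z
  -- Without a vertex of degree three, `K` together with `d` would be closed with all degrees two,
  -- which `hcyc` excludes.
  intro K hK haK hbK
  by_contra hno
  refine hcyc ⟨insert d K, ⟨Finset.insert_subset hd (hK.1.trans (Finset.erase_subset _ _)), ?_⟩,
    Finset.mem_insert_self _ _, ?_⟩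
  · intro u hu v hv huv
    by_cases hvd : v = d
    · rw [hvd]; exact Finset.mem_insert_self _ _
    refine Finset.mem_insert_of_mem ?_
    rcases Finset.mem_insert.1 hu with rfl | hu
    · rcases hnb v hv huv with rfl | rfl <;> assumption
    · exact hK.2 u hu v (Finset.mem_erase.2 ⟨hvd, hv⟩) huv
  · intro u hu
    rcases Finset.mem_insert.1 hu with rfl | hu
    · exact hd2
    by_cases hua : u = a
    · rw [hua, ha2]
    by_cases hub : u = b
    · rw [hub, hb2]
    have huU := hK.1 hu
    rw [← h.dg_other (Finset.mem_of_mem_erase huU) hua hub]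
    exact (h.dg_other_mem u huU hua hub).resolve_right fun h => hno ⟨u, hu, h⟩

/-- The edge `db` is the only link between the cycle and the rest. The rest is drawn with `a`
highest and off the vertical line of `d`, then `d` is added diagonally above `a`, and finally the
cycle is hung upside down above `d`. -/
theorem Branch.exists_fits_of_lollipop {U : Finset V} {d a b : V} (h : Branch G U d a b)
    (ihT : ∀ W : Finset V, W.card < U.card → ∀ a, TopDrawable G W a)
    (hcyc : ∃ K, IsClosedIn G (U.erase d) K ∧ b ∈ K ∧ a ∉ K ∧ ∀ u ∈ K, dg G (U.erase d) u = 2)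
    {x : V → ℝ} (hx : LinearIndepOn ℚ x (Presc G U ∅)) :
    ∃ X Y, Fits G U (Presc G U ∅) x X Y := by
  obtain ⟨K, hK, hbK, haK, hK2⟩ := hcyc
  obtain ⟨C, hCK, hC, hbC, hcyc⟩ := exists_cycleDrawn hK hbK hK2
  have haC : a ∉ C := fun h => haK (hCK h)
  have hC2 : ∀ u ∈ C, dg G (U.erase d) u = 2 := fun u hu => hK2 u (hCK hu)
  have hb3 : dg G U b = 3 := by
    have := h.symm.dg_left
    have := hC2 b hbC
    omega
  have hdC : d ∉ C := fun h => Finset.notMem_erase d U (hC.1 h)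
  have hCU : C ⊆ U := hC.1.trans (Finset.erase_subset _ _)
  have hdP : d ∈ Presc G U ∅ := ⟨h.mem, Or.inr ⟨h.dg_eq, by simp⟩⟩
  have hbP : b ∉ Presc G U ∅ := by rintro ⟨-, h | h⟩ <;> omega
  have hCP : ∀ u ∈ C, u ≠ b → u ∈ Presc G U ∅ := fun u hu hub =>
    ⟨hCU hu, Or.inr ⟨by
      rw [← h.dg_other (hCU hu) (by rintro rfl; exact haC hu) hub]; exact hC2 u hu, by simp⟩⟩
  have hmem : ∀ v ∈ U.erase d \ C, v ∈ U.erase d ∧ v ∉ C := fun v hv => Finset.mem_sdiff.1 hv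
  have hneb : ∀ v ∈ U.erase d \ C, v ≠ b := by rintro v hv rfl; exact (hmem v hv).2 hbC
  have hdg' : ∀ v ∈ U.erase d \ C, dg G (U.erase d \ C) v = dg G (U.erase d) v := fun v hv =>
    dg_sdiff hC (hmem v hv).1 (hmem v hv).2
  have ha' : a ∈ U.erase d \ C := Finset.mem_sdiff.2 ⟨h.left_mem_erase, haC⟩
  have hPP : Presc G (U.erase d \ C) {a} = (Presc G U ∅ \ C) \ {d} := by
    have : (Presc G U ∅ \ C) \ {d} = Presc G (U.erase d) {a, b} \ C := by
      rw [h.presc_erase, h.presc_empty]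
      ext v
      by_cases hvd : v = d
      · subst hvd; simp [h.notMem_presc]
      · simp [hvd]
    rw [this]
    ext v
    by_cases hv : v ∈ U.erase d \ C
    · have h1 := hmem v hv
      simp only [Presc, Set.mem_ofPred_eq, Set.mem_sdiff, hdg' v hv, hv, h1.1, Finset.mem_coe,
        h1.2, Finset.mem_insert, Finset.mem_singleton, hneb v hv, or_false, not_false_eq_true,
        and_true]
    · constructor
      · exact fun h => absurd h.1 hv
      · exact fun h => absurd (Finset.mem_sdiff.2 ⟨h.1.1, h.2⟩) hv
  have hsub : Presc G (U.erase d \ C) {a} ⊆ Presc G U ∅ \ {d} := by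
    rw [hPP]; exact fun v hv => ⟨hv.1.1, hv.2⟩
  obtain ⟨X, Y, hF, htop, hXa⟩ := ihT (U.erase d \ C)
    ((Finset.card_le_card Finset.sdiff_subset).trans_lt h.card_lt) a ha'
    (by rw [hdg' a ha']; exact h.dg_left_mem)
    (fun v hv hva => by
      rw [hdg' v hv]; exact h.dg_other_mem v (hmem v hv).1 hva (hneb v hv))
    (fun K hK hne haK => (h.mixed_other K (hC.of_sdiff hK) hne haK
      fun hb => hneb b (hK.1 hb) rfl).congr fun v hv => hdg' v (hK.1 hv))
    x (hx.mono (hsub.trans Set.sdiff_subset)) (x d)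
    (fun hs => hx.notMem_span hdP (Submodule.span_mono (Set.image_mono hsub) hs))
  have hUC : insert d (U.erase d \ C) = U \ C := by
    rw [← Finset.insert_sdiff_of_notMem _ hdC, h.insert_erase]
  obtain ⟨X₁, Y₁, h1, h2, -, -⟩ := hF.insert_over (x := x) (Q := Presc G U ∅ \ C) presc_subset ha'
    htop (fun h => Finset.notMem_erase d U (hmem d h).1) hXa.symm
    (fun u hu hdu => Or.inl ((h.nbr u (Finset.mem_of_mem_erase (hmem u hu).1) hdu).resolve_right
      (hneb u hu)))
    (fun e he => by
      by_cases hed : e = d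
      · exact Or.inl ⟨hed, by rw [hed]⟩
      · exact Or.inr ⟨by rw [hPP]; exact ⟨he, hed⟩, rfl, fun h => hed (hx.injOn he.1 hdP h)⟩)
  rw [hUC] at h1 h2
  obtain ⟨X₂, Y₂, σ, h₂⟩ := hcyc x (hx.injOn.mono fun u hu => by
    have hu := Finset.mem_erase.1 (Finset.mem_coe.1 hu)
    exact hCP u hu.2 hu.1)
  refine Fits.cycle_on_top hCU ?_ hbC (Finset.mem_sdiff.2 ⟨h.mem, hdC⟩) hdP hx presc_subset hbP hCP
    h1 h2 h₂
  intro u hu v hv huv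
  have hv := Finset.mem_sdiff.1 hv
  have hvd : v = d := by
    by_contra hvd
    exact hv.2 (hC.2 u hu v (Finset.mem_erase.2 ⟨hvd, hv.1⟩) huv)
  subst hvd
  exact ⟨(h.nbr u (hCU hu) huv.symm).resolve_left (by rintro rfl; exact haC hu), rfl⟩

theorem drawable_of_forall_lt {U : Finset V}
    (ihT : ∀ W : Finset V, W.card < U.card → ∀ a, TopDrawable G W a) : Drawable G U := by
  intro hdg hgood x hx
  rcases U.eq_empty_or_nonempty with rfl | hne
  · exact ⟨0, 0, Drawn.empty _ _, fun d hd => absurd hd.1 (by simp), fun d hd => absurd hd.1 (by simp)⟩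
  have hex : ∃ d ∈ U, dg G U d = 2 ∧ ∃ b ∈ U, G.Adj d b ∧ dg G U b = 3 := by
    by_contra hno
    push Not at hno
    obtain ⟨⟨v, hv, hv2⟩, -⟩ := hgood U ⟨subset_rfl, fun _ _ v hv _ => hv⟩ hne
    -- If no vertex of degree two had a neighbour of degree three, the vertices of degree two would
    -- form a closed set without a vertex of degree three.
    obtain ⟨-, w, hw, hw3⟩ := hgood (U.filter fun v => dg G U v = 2)
      ⟨Finset.filter_subset _ _, fun u hu v hv huv => by
        have hu := Finset.mem_filter.1 hu
        exact Finset.mem_filter.2 ⟨hv, (hdg v hv).resolve_right (hno u hu.1 hu.2 v hv huv)⟩⟩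
      ⟨v, Finset.mem_filter.2 ⟨hv, hv2⟩⟩
    have := (Finset.mem_filter.1 hw).2
    omega
  obtain ⟨d, hd, hd2, b, hb, hdb, hb3⟩ := hex
  have hB : ∃ a, Branch G U d a b := by
    obtain ⟨a, ha, b', hb', hab, hda, hdb', hnb⟩ := exists_nbrs_of_dg_eq_two hd2
    have h : Branch G U d a b' := ⟨hd, ha, hb', hab, hda, hdb', hnb, hd2, hdg,
      fun K hK hne _ => hgood K hK hne⟩
    rcases hnb b hb hdb with rfl | rfl
    · exact ⟨b', h.symm⟩
    · exact ⟨a, h⟩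
  obtain ⟨a, h⟩ := hB
  by_cases hcyc : ∃ K, IsClosedIn G (U.erase d) K ∧ b ∈ K ∧ a ∉ K ∧
      ∀ u ∈ K, dg G (U.erase d) u = 2
  · exact h.exists_fits_of_lollipop ihT hcyc hx
  have hdP : d ∈ Presc G U ∅ := ⟨hd, Or.inr ⟨hd2, by simp⟩⟩
  have hsub : Presc G U {d} ⊆ Presc G U ∅ \ {d} := by
    rw [h.presc_empty]
    exact fun v hv => ⟨Or.inr hv, by rintro rfl; exact h.notMem_presc hv⟩
  obtain ⟨X, Y, hF, -, hXd, hfree⟩ := h.exists_fits_above (ihT _ h.card_lt a) hb3 hcyc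
    (hx.mono (hsub.trans Set.sdiff_subset)) (ξ := x d)
    (fun hs => hx.notMem_span hdP (Submodule.span_mono (Set.image_mono hsub) hs))
  refine ⟨X, Y, hF.drawn, ?_, ?_⟩ <;> rw [h.presc_empty]
  · rintro e (rfl | he)
    · exact hXd
    · exact hF.eq e he
  · rintro e (rfl | he)
    · exact hfree
    · exact hF.free e he

theorem drawable (U : Finset V) : Drawable G U := by
  have main : ∀ n : ℕ, ∀ U : Finset V, U.card < n →
      Drawable G U ∧ (∀ a, TopDrawable G U a) ∧ ∀ a b, SplitDrawable G U a b := by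
    intro n
    induction n with
    | zero => exact fun U hU => absurd hU (Nat.not_lt_zero _)
    | succ n ih =>
      intro U hU
      have ih' := fun W (hW : W.card < U.card) => ih W (by omega)
      have ihD := fun W hW => (ih' W hW).1
      have ihT := fun W hW => (ih' W hW).2.1
      have ihS := fun W hW => (ih' W hW).2.2
      exact ⟨drawable_of_forall_lt ihT, topDrawable_of_forall_lt ihD ihT ihS,
        splitDrawable_of_forall_lt ihT ihS⟩
  exact (main _ U (Nat.lt_succ_self _)).1

/-! ### Joining the two parts -/

theorem exists_linearIndepOn {P : Set V} (hP : P.Finite) : ∃ x : V → ℝ, LinearIndepOn ℚ x P := by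
  induction P, hP using Set.Finite.induction_on with
  | empty => exact ⟨0, linearIndepOn_empty _ _⟩
  | @insert b P hb hP ih =>
    obtain ⟨x, hx⟩ := ih
    obtain ⟨ξ, hξ, -⟩ := exists_notMem_span hP x 0
    exact ⟨_, linearIndepOn_update hx hb hξ⟩

theorem dg_pos_of_adj {U : Finset V} {u v : V} (hu : u ∈ U) (h : G.Adj v u) : 0 < dg G U v :=
  Finset.card_pos.2 ⟨u, Finset.mem_filter.2 ⟨hu, h⟩⟩

/-- Each vertex has at most one neighbour in the other part. Hence the map `m` from the degree-two
vertices of `W` to their partners in `U` is injective, and the transported abscissas `x ∘ m` are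
again independent. -/
theorem exists_drawn_union {U W : Finset V} (hUW : Disjoint U W)
    (hU : ∀ v ∈ U, dg G U v = 2 ∨ dg G U v = 3) (hW : ∀ v ∈ W, dg G W v = 2 ∨ dg G W v = 3)
    (hUW3 : ∀ v ∈ U ∪ W, dg G U v + dg G W v = 3)
    (hmU : ∀ K, IsClosedIn G U K → K.Nonempty → Mixed G U K)
    (hmW : ∀ K, IsClosedIn G W K → K.Nonempty → Mixed G W K) :
    ∃ X Y, Drawn G (U ∪ W) X Y := by
  obtain ⟨x, hx⟩ := exists_linearIndepOn (presc_finite (G := G) U ∅)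
  have hPU : ∀ u ∈ U, ∀ w ∈ W, G.Adj u w → u ∈ Presc G U ∅ ∧ dg G W u = 1 := by
    intro u hu w hw huw
    have h1 := dg_pos_of_adj hw huw
    have h2 := hU u hu
    have h3 := hUW3 u (Finset.mem_union_left _ hu)
    exact ⟨⟨hu, Or.inr ⟨by omega, by simp⟩⟩, by omega⟩
  have hPW : ∀ u ∈ U, ∀ w ∈ W, G.Adj u w → w ∈ Presc G W ∅ := by
    intro u hu w hw huw
    have h1 := dg_pos_of_adj hu huw.symm
    have h2 := hW w hw
    have h3 := hUW3 w (Finset.mem_union_right _ hw)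
    exact ⟨hw, Or.inr ⟨by omega, by simp⟩⟩
  have hex : ∀ w, ∃ m, w ∈ Presc G W ∅ → m ∈ U ∧ G.Adj w m ∧ ∀ u ∈ U, G.Adj w u → u = m := by
    intro w
    by_cases hw : w ∈ Presc G W ∅
    · have h1 : dg G U w = 1 := by
        have h2 := hW w hw.1
        have h3 := hUW3 w (Finset.mem_union_right _ hw.1)
        rcases hw.2 with h | h <;> omega
      obtain ⟨m, h⟩ := exists_nbr_of_dg_eq_one h1
      exact ⟨m, fun _ => h⟩
    · exact ⟨w, fun h => absurd h hw⟩
  choose m hm using hex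
  have hmP : m '' Presc G W ∅ ⊆ Presc G U ∅ := by
    rintro _ ⟨w, hw, rfl⟩
    exact (hPU _ (hm w hw).1 w hw.1 (hm w hw).2.1.symm).1
  have hinj : Set.InjOn m (Presc G W ∅) := by
    intro w hw w' hw' he
    obtain ⟨h1, h2, -⟩ := hm w hw
    obtain ⟨e, -, -, he'⟩ := exists_nbr_of_dg_eq_one (hPU _ h1 w hw.1 h2.symm).2
    rw [he' w hw.1 h2.symm, he' w' hw'.1 (by rw [he]; exact (hm w' hw').2.1.symm)]
  obtain ⟨X₁, Y₁, h₁⟩ := drawable U hU hmU x hx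
  obtain ⟨X₂, Y₂, h₂⟩ := drawable W hW hmW (x ∘ m) ((hx.mono hmP).comp_of_image hinj)
  obtain ⟨B, hB⟩ := exists_gt_all U Y₁
  obtain ⟨c, hc⟩ := exists_add_gt W (fun v => - Y₂ v) B
  have hnot : ∀ v ∈ W, v ∉ U := fun v hv hu => Finset.disjoint_left.1 hUW hu hv
  set X := U.piecewise X₁ X₂ with hX
  set Y := U.piecewise Y₁ (fun v => - Y₂ v + c) with hY
  have hXU : ∀ u ∈ U, X u = X₁ u := fun u hu => Finset.piecewise_eq_of_mem _ _ _ hu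
  have hYU : ∀ u ∈ U, Y u = Y₁ u := fun u hu => Finset.piecewise_eq_of_mem _ _ _ hu
  have hXW : ∀ u ∈ W, X u = X₂ u := fun u hu => Finset.piecewise_eq_of_notMem _ _ _ (hnot u hu)
  have hYW : ∀ u ∈ W, Y u = - Y₂ u + c := fun u hu =>
    Finset.piecewise_eq_of_notMem _ _ _ (hnot u hu)
  refine ⟨X, Y, (h₁.drawn.congr hXU hYU).stack ((h₂.drawn.flip.shift c).congr hXW hYW) ?_ ?_⟩
  · intro u hu v hv
    rw [hYU u hu, hYW v hv]
    exact (hB u hu).trans (hc v hv)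
  · intro u hu v hv huv
    have hu' := (hPU u hu v hv huv).1
    have hv' := hPW u hu v hv huv
    left
    refine ⟨?_, (h₁.free u hu').congr hu hXU hYU, ?_⟩
    · rw [hXU u hu, hXW v hv, h₁.eq u hu', h₂.eq v hv', Function.comp_apply,
        ← (hm v hv').2.2 u hu huv.symm]
    · intro w hw hwv he
      rw [hXW w hw, hXW v hv] at he
      rw [hYW w hw, hYW v hv]
      linarith [h₂.free v hv' w hw hwv he]

/-! ### Drawings of the whole graph -/

theorem hasSlope_of_slope {X Y X' Y' : ℝ} (hne : ¬ (X = X' ∧ Y = Y'))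
    (h : X = X' ∨ Y = Y' ∨ |X - X'| = |Y - Y'|) :
    ∃ θ ∈ basicSlopes, HasSlope θ (X, Y) (X', Y') := by
  have hs : (√2 : ℝ) * (√2 / 2) = 1 := by
    have := Real.mul_self_sqrt (show (0 : ℝ) ≤ 2 by norm_num)
    linarith
  have hs0 : (√2 : ℝ) ≠ 0 := by positivity
  rcases h with h | h | h
  · refine ⟨Real.pi / 2, by simp [basicSlopes], Y' - Y, fun h' => hne ⟨h, by linarith⟩, ?_⟩
    ext <;> simp [h]
  · refine ⟨0, by simp [basicSlopes], X' - X, fun h' => hne ⟨by linarith, h⟩, ?_⟩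
    ext <;> simp [h]
  · by_cases hX : X = X'
    · rw [hX, sub_self, abs_zero] at h
      exact absurd ⟨hX, sub_eq_zero.1 (abs_eq_zero.1 h.symm)⟩ hne
    rcases abs_eq_abs.1 h with h | h
    · refine ⟨Real.pi / 4, by simp [basicSlopes], (X' - X) * √2,
        mul_ne_zero (sub_ne_zero.2 (Ne.symm hX)) hs0, ?_⟩
      ext
      · simp only [Prod.fst_sub, Prod.smul_fst, smul_eq_mul, Real.cos_pi_div_four, mul_assoc, hs]
        ring
      · simp only [Prod.snd_sub, Prod.smul_snd, smul_eq_mul, Real.sin_pi_div_four, mul_assoc, hs]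
        linarith
    · have hθ : 3 * Real.pi / 4 = Real.pi - Real.pi / 4 := by ring
      -- The direction is `(-√2/2, √2/2)`, which reverses the sign of the factor compared with the
      -- slope `π/4`.
      refine ⟨3 * Real.pi / 4, by simp [basicSlopes], (X - X') * √2,
        mul_ne_zero (sub_ne_zero.2 hX) hs0, ?_⟩
      ext
      · simp only [Prod.fst_sub, Prod.smul_fst, smul_eq_mul, hθ, Real.cos_pi_sub,
          Real.cos_pi_div_four, mul_assoc, mul_neg, hs]
        ring
      · simp only [Prod.snd_sub, Prod.smul_snd, smul_eq_mul, hθ, Real.sin_pi_sub,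
          Real.sin_pi_div_four, mul_assoc, hs]
        linarith

theorem Drawn.canBeDrawnWith {U : Finset V} {X Y : V → ℝ} (h : Drawn G U X Y) (hU : ∀ v, v ∈ U) :
    CanBeDrawnWith G basicSlopes := by
  refine ⟨fun v => (X v, Y v), ⟨fun u v huv => ?_, ?_⟩, fun u v huv => ?_⟩
  · exact h.inj u (hU u) v (hU v) (congrArg Prod.fst huv) (congrArg Prod.snd huv)
  · intro u v huv w hwu hwv hw
    rw [segment_eq_image'] at hw
    obtain ⟨t, ⟨h0, h1⟩, ht⟩ := hw
    refine h.clear u (hU u) v (hU v) huv w (hU w) hwu hwv t h0 h1 ?_ ?_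
    · simpa using (congrArg Prod.fst ht).symm
    · simpa using (congrArg Prod.snd ht).symm
  · exact hasSlope_of_slope (fun he => huv.ne (h.inj u (hU u) v (hU v) he.1 he.2))
      (h.slope u (hU u) v (hU v) huv)

/-! ### Components after deleting the cut-edges -/

theorem mem_of_reachable {H : SimpleGraph V} {p : V → Prop}
    (hp : ∀ u v, p u → H.Adj u v → p v) {u v : V} (h : H.Reachable u v) (hu : p u) : p v := by
  obtain ⟨w⟩ := h
  induction w with
  | nil => exact hu
  | cons h _ ih => exact ih (hp _ _ hu h)

theorem mem_cutEdges_iff {A : Set V} {u v : V} (h : G.Adj u v) :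
    s(u, v) ∈ cutEdges G A ↔ ¬ (u ∈ A ↔ v ∈ A) := by
  constructor
  · rintro ⟨-, a, ha, b, hb, he⟩
    rcases Sym2.eq_iff.1 he with ⟨rfl, rfl⟩ | ⟨rfl, rfl⟩
    · exact fun h => hb (h.1 ha)
    · exact fun h => hb (h.2 ha)
  · intro hn
    by_cases hu : u ∈ A
    · exact ⟨h, u, hu, v, fun hv => hn ⟨fun _ => hv, fun _ => hu⟩, rfl⟩
    · exact ⟨h, v, by by_contra hv; exact hn ⟨fun h => absurd h hu, fun h => absurd h hv⟩, u, hu,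
        Sym2.eq_swap⟩

theorem mem_iff_of_reachable {A : Set V} {u v : V}
    (h : (G.deleteEdges (cutEdges G A)).Reachable u v) : u ∈ A ↔ v ∈ A := by
  refine mem_of_reachable (p := fun w => u ∈ A ↔ w ∈ A) (fun w w' hw hww' => ?_) h Iff.rfl
  rw [SimpleGraph.deleteEdges_adj] at hww'
  rw [hw]
  by_contra hn
  exact hww'.2 ((mem_cutEdges_iff hww'.1).2 hn)

theorem adj_iff_of_reachable {A : Set V} {u v : V}
    (h : (G.deleteEdges (cutEdges G A)).Reachable u v) :
    (G.deleteEdges (cutEdges G A)).Adj u v ↔ G.Adj u v := by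
  rw [SimpleGraph.deleteEdges_adj]
  exact ⟨fun h => h.1, fun h' => ⟨h', fun hc => (mem_cutEdges_iff h').1 hc (mem_iff_of_reachable h)⟩⟩

/-- The vertex set of a component, as a finset. -/
noncomputable def componentFinset [Fintype V] {H : SimpleGraph V} (c : H.ConnectedComponent) :
    Finset V :=
  Finset.univ.filter fun v => H.connectedComponentMk v = c

theorem mem_componentFinset [Fintype V] {H : SimpleGraph V} {c : H.ConnectedComponent} {v : V} :
    v ∈ componentFinset c ↔ H.connectedComponentMk v = c := by simp [componentFinset]

/-- Two vertices of one component lie on the same side of the cut, so no edge between them was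
deleted: the component is an induced subgraph of `G`. -/
theorem ncard_neighborSet_eq_dg [Fintype V] {A : Set V}
    (c : (G.deleteEdges (cutEdges G A)).ConnectedComponent) (v : c) :
    (c.toSimpleGraph.neighborSet v).ncard = dg G (componentFinset c) v := by
  rw [dg, ← Set.ncard_coe_finset, ← Set.ncard_image_of_injective _ Subtype.val_injective]
  congr 1
  ext u
  have hv : (G.deleteEdges (cutEdges G A)).connectedComponentMk v = c := v.2
  simp only [Set.mem_image, SimpleGraph.mem_neighborSet, Subtype.exists, exists_and_right,
    exists_eq_right, Finset.coe_filter, Set.mem_ofPred_eq, mem_componentFinset]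
  constructor
  · rintro ⟨hu, h⟩
    have hu' : (G.deleteEdges (cutEdges G A)).connectedComponentMk u = c := hu
    exact ⟨hu', (adj_iff_of_reachable
      (SimpleGraph.ConnectedComponent.exact (hv.trans hu'.symm))).1 h⟩
  · rintro ⟨hu, h⟩
    exact ⟨hu, (adj_iff_of_reachable (SimpleGraph.ConnectedComponent.exact (hv.trans hu.symm))).2 h⟩

/-- By connectedness a nonempty closed subset is the whole component; a supercycle has a vertex
whose degree is not two. -/
theorem mixed_component [Fintype V] {A : Set V}
    {c : (G.deleteEdges (cutEdges G A)).ConnectedComponent}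
    (hc : IsSupercycle c.toSimpleGraph)
    (hdg : ∀ v ∈ componentFinset c, dg G (componentFinset c) v = 2 ∨
      dg G (componentFinset c) v = 3)
    (h2 : ∃ v ∈ componentFinset c, dg G (componentFinset c) v = 2) (K : Finset V)
    (hK : IsClosedIn G (componentFinset c) K) (hne : K.Nonempty) :
    Mixed G (componentFinset c) K := by
  obtain ⟨k, hk⟩ := hne
  have hkc := mem_componentFinset.1 (hK.1 hk)
  have hKU : K = componentFinset c := by
    refine hK.1.antisymm fun v hv => ?_
    refine mem_of_reachable (p := fun v => v ∈ K) (fun u w hu huw => ?_)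
      (SimpleGraph.ConnectedComponent.exact (hkc.trans (mem_componentFinset.1 hv).symm)) hk
    refine hK.2 u hu w (mem_componentFinset.2 ?_) (SimpleGraph.deleteEdges_adj.1 huw).1
    rw [← mem_componentFinset.1 (hK.1 hu)]
    exact SimpleGraph.ConnectedComponent.sound huw.symm.reachable
  subst hKU
  refine ⟨h2, ?_⟩
  by_contra hno
  refine hc.2.2 fun v => ?_
  rw [ncard_neighborSet_eq_dg]
  have hv : (v : V) ∈ componentFinset c := mem_componentFinset.2 v.2
  exact (hdg v hv).resolve_right fun h => hno ⟨v, hv, h⟩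

end FourSlopes

open FourSlopes

theorem lemma2p8 {V : Type*} [Finite V] (G : SimpleGraph V) [G.LocallyFinite]
    (hconn : G.Connected) (hcubic : G.IsRegularOfDegree 3)
    (hcut : ∃ A : Set V, FourSlopes.IsSuitableMCut G A) :
    FourSlopes.CanBeDrawnWith G FourSlopes.basicSlopes := by
  classical
  have := Fintype.ofFinite V
  obtain ⟨A, -, hcard, hsup⟩ := hcut
  obtain ⟨c₁, c₂, hne, huniv⟩ := Nat.card_eq_two_iff.1 hcard
  have hor : ∀ c, c = c₁ ∨ c = c₂ := fun c => by
    have : c ∈ ({c₁, c₂} : Set _) := huniv ▸ Set.mem_univ c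
    simpa using this
  have hdisj : Disjoint (componentFinset c₁) (componentFinset c₂) :=
    Finset.disjoint_left.2 fun v h1 h2 =>
      hne ((mem_componentFinset.1 h1).symm.trans (mem_componentFinset.1 h2))
  have hall : ∀ v, v ∈ componentFinset c₁ ∪ componentFinset c₂ := fun v => by
    rw [Finset.mem_union, mem_componentFinset, mem_componentFinset]; exact hor _
  have h3 : ∀ v, dg G (componentFinset c₁) v + dg G (componentFinset c₂) v = 3 := by
    intro v
    rw [dg, dg, ← Finset.card_union_of_disjoint (Finset.disjoint_filter_filter hdisj),
      ← Finset.filter_union, ← hcubic v, ← SimpleGraph.card_neighborFinset_eq_degree]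
    congr 1
    ext u
    simp only [Finset.mem_filter, hall, true_and, SimpleGraph.mem_neighborFinset]
  have hdg : ∀ c, ∀ v ∈ componentFinset c, 2 ≤ dg G (componentFinset c) v := fun c v hv => by
    have := (hsup c).2.1 ⟨v, mem_componentFinset.1 hv⟩
    rwa [ncard_neighborSet_eq_dg] at this
  have hdg₁ : ∀ v ∈ componentFinset c₁, dg G (componentFinset c₁) v = 2 ∨
      dg G (componentFinset c₁) v = 3 := fun v hv => by
    have := hdg c₁ v hv
    have := h3 v
    omega
  have hdg₂ : ∀ v ∈ componentFinset c₂, dg G (componentFinset c₂) v = 2 ∨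
      dg G (componentFinset c₂) v = 3 := fun v hv => by
    have := hdg c₂ v hv
    have := h3 v
    omega
  -- Since `G` is connected, some edge joins the two components; its ends supply the vertices of
  -- degree two that `Mixed` asks for.
  obtain ⟨u, hu, v, hv, huv⟩ : ∃ u ∈ componentFinset c₁, ∃ v ∈ componentFinset c₂, G.Adj u v := by
    by_contra hno
    push Not at hno
    obtain ⟨u, hu⟩ := c₁.exists_rep
    obtain ⟨v, hv⟩ := c₂.exists_rep
    have hv' : v ∈ componentFinset c₁ := mem_of_reachable (p := fun v => v ∈ componentFinset c₁)
      (fun a b ha hab => (Finset.mem_union.1 (hall b)).resolve_right fun hb => hno a ha b hb hab)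
      (hconn.preconnected u v) (mem_componentFinset.2 hu)
    exact Finset.disjoint_left.1 hdisj hv' (mem_componentFinset.2 hv)
  have hu2 : dg G (componentFinset c₁) u = 2 := by
    have := dg_pos_of_adj hv huv
    have := hdg c₁ u hu
    have := h3 u
    omega
  have hv2 : dg G (componentFinset c₂) v = 2 := by
    have := dg_pos_of_adj hu huv.symm
    have := hdg c₂ v hv
    have := h3 v
    omega
  obtain ⟨X, Y, h⟩ := exists_drawn_union hdisj hdg₁ hdg₂ (fun v _ => h3 v)
    (mixed_component (hsup c₁) hdg₁ ⟨u, hu, hu2⟩) (mixed_component (hsup c₂) hdg₂ ⟨v, hv, hv2⟩)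
  exact h.canBeDrawnWith hall
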